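/- Let $F\subset \mathrm{Sym}^2(\mathbb R^n)$ be a closed set of real symmetric $n\times n$ matrices such that - (positivity) $A+P\in F$ for all $A\in F$ and all positive semidefinite $P$ ("$F$ is a subequation"); - (cone property) $tF\subset F$ for all real $t\ge 0$; - $F$ is convex; - (ST-invariance) there is a subgroup $G\subset \mathrm O(n)$ acting transitively on the unit sphere $S=S^{n-1}$ with $gAg^{T}\in F$ for all $g\in G$, $A\in F$. For an open set $X\subset\mathbb R^n$, a function $u:X\to[-\infty,\infty)$ is *$F$-subharmonic* on $X$ if it is upper semicontinuous and, whenever $x\in X$ and $\varphi$ is a $C^2$ function near $x$ with $u\le\varphi$ near $x$ and $u(x)=\varphi(x)$, one has $D^2_x\varphi\in F$. It is *$F$-harmonic* on $X$ if $u$ is $F$-subharmonic and $-u$ is $\widetilde F$-subharmonic on $X$, where $\widetilde F=-(\mathrm{Sym}^2(\mathbb R^n)\setminus \mathrm{Int}\,F)$ (so $u$ is then real-valued and continuous). An $F$-subharmonic function $u$ on $X$ is *$F$-maximal* on $X$ if for each $F$-subharmonic function $v$ on $X$ and each compact set $K\subset X$, $$v\le u \ \text{ on } X\setminus K\quad\Longrightarrow\quad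 v\le u\ \text{ on } X .$$ **Theorem (Maximality Criterion).** Let $0\le a$ and $b\le\infty$, let $A=A(a,b)=\{x\in\mathbb R^n: a<|x|<b\}$, and let $U$ be an $F$-subharmonic function on $A$, with spherical averages $$S(U,t)=\frac1{|S|}\int_S U(t\sigma)\,d\sigma\in[-\infty,\infty),\qquad a<t<b .$$ If $t\mapsto S(U,t)$ is increasing (i.e. non-decreasing) on $(a,b)$ and $x\mapsto S(U,|x|)$ is $F$-harmonic on $A$, then $U$ is $F$-maximal on $A$. -/

import Mathlib

open MeasureTheory Topology

noncomputable section

namespace STCone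

/-- Euclidean space `ℝⁿ`. -/
abbrev Rn (n : ℕ) : Type := EuclideanSpace ℝ (Fin n)

/-- The space `Sym²(ℝⁿ)` of real symmetric `n × n` matrices (as the self-adjoint elements of the
matrix ring), with its topology and its real vector space structure. -/
abbrev SymMat (n : ℕ) : Type := selfAdjoint (Matrix (Fin n) (Fin n) ℝ)

/-- The action `A ↦ g A gᵀ` of `O(n)` on symmetric matrices. -/
def conj {n : ℕ} (g : Matrix.orthogonalGroup (Fin n) ℝ) (A : SymMat n) : SymMat n :=
  ⟨(g : Matrix (Fin n) (Fin n) ℝ) * (A : Matrix (Fin n) (Fin n) ℝ) *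
    star (g : Matrix (Fin n) (Fin n) ℝ), A.2.conjugate' _⟩

/-- A (constant coefficient, pure second order) subequation: a closed set `F` of symmetric
matrices such that `F + {P ≥ 0} ⊆ F`. -/
structure IsSubequation {n : ℕ} (F : Set (SymMat n)) : Prop where
  isClosed : IsClosed F
  positivity : ∀ A ∈ F, ∀ P : SymMat n, (P : Matrix (Fin n) (Fin n) ℝ).PosSemidef → A + P ∈ F

/-- The cone property: `t F ⊆ F` for all `t ≥ 0`. -/
def IsCone {n : ℕ} (F : Set (SymMat n)) : Prop :=
  ∀ t : ℝ, 0 ≤ t → ∀ A ∈ F, t • A ∈ F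

/-- ST-invariance: `F` is invariant under some subgroup of `O(n)` which acts transitively on the
unit sphere. -/
def IsSTInvariant {n : ℕ} (F : Set (SymMat n)) : Prop :=
  ∃ G : Subgroup (Matrix.orthogonalGroup (Fin n) ℝ),
    (∀ x y : Rn n, ‖x‖ = 1 → ‖y‖ = 1 →
      ∃ g ∈ G, Matrix.toEuclideanLin (g : Matrix (Fin n) (Fin n) ℝ) x = y) ∧
    ∀ g ∈ G, ∀ A ∈ F, conj g A ∈ F

/-- The Hessian matrix `D²φ(x)`. -/
def hessian {n : ℕ} (φ : Rn n → ℝ) (x : Rn n) : Matrix (Fin n) (Fin n) ℝ :=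
  Matrix.of fun i j =>
    fderiv ℝ (fderiv ℝ φ) x (EuclideanSpace.single i 1) (EuclideanSpace.single j 1)

/-- `F`-subharmonic functions on an open set `X`, in the viscosity sense: `u` is upper
semicontinuous on `X` with values in `[-∞, ∞)`, and `D²φ(x) ∈ F` whenever `φ` is `C²` near a point
`x ∈ X` and touches `u` from above at `x`. (Values of `u` outside `X` are irrelevant.) -/
structure IsSubharmonic {n : ℕ} (F : Set (SymMat n)) (X : Set (Rn n)) (u : Rn n → EReal) :
    Prop where
  usc : UpperSemicontinuousOn u X
  lt_top : ∀ x ∈ X, u x < ⊤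
  viscosity : ∀ x ∈ X, ∀ φ : Rn n → ℝ, ContDiffAt ℝ 2 φ x →
    (∀ᶠ y in 𝓝 x, u y ≤ (φ y : EReal)) → u x = (φ x : EReal) →
    ∃ A ∈ F, (A : Matrix (Fin n) (Fin n) ℝ) = hessian φ x

/-- The dual subequation `F̃ = -(∼ Int F)`, the interior being taken in `Sym²(ℝⁿ)`. -/
def dual {n : ℕ} (F : Set (SymMat n)) : Set (SymMat n) :=
  {A | -A ∉ interior F}

/-- `F`-harmonic functions: `u` is `F`-subharmonic and `-u` is `F̃`-subharmonic. In particular `u`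
is real-valued and continuous on `X`. -/
def IsHarmonic {n : ℕ} (F : Set (SymMat n)) (X : Set (Rn n)) (u : Rn n → EReal) : Prop :=
  IsSubharmonic F X u ∧ IsSubharmonic (dual F) X (fun x => -u x)

/-- `F`-maximal functions on an open set `X`. -/
def IsMaximal {n : ℕ} (F : Set (SymMat n)) (X : Set (Rn n)) (u : Rn n → EReal) : Prop :=
  IsSubharmonic F X u ∧
    ∀ v : Rn n → EReal, IsSubharmonic F X v →
      ∀ K : Set (Rn n), K ⊆ X → IsCompact K →
        (∀ x ∈ X \ K, v x ≤ u x) → ∀ x ∈ X, v x ≤ u x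

/-- The open annulus `A(a, b) = {x : a < |x| < b}`; the outer radius `b` may be `∞`. -/
def annulus (n : ℕ) (a : ℝ) (b : EReal) : Set (Rn n) :=
  {x | a < ‖x‖ ∧ (‖x‖ : EReal) < b}

/-- Normalized surface measure on the unit sphere. -/
def sphereMeasure (n : ℕ) : Measure (Metric.sphere (0 : Rn n) 1) :=
  ((volume : Measure (Rn n)).toSphere Set.univ)⁻¹ • (volume : Measure (Rn n)).toSphere

/-- The spherical average `S(u, t) = ⨍ u(tσ) dσ ∈ [-∞, ∞)`, as the integral of the positive part
minus the integral of the negative part. If `u` is upper semicontinuous with values `< ∞` on the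
sphere of radius `t`, the positive part is bounded, so that the first integral is finite. -/
def sphericalAverage {n : ℕ} (u : Rn n → EReal) (t : ℝ) : EReal :=
  ((∫⁻ σ : Metric.sphere (0 : Rn n) 1, (u (t • (σ : Rn n))).toENNReal ∂(sphereMeasure n) :
      ENNReal) : EReal) -
    ((∫⁻ σ : Metric.sphere (0 : Rn n) 1, (-u (t • (σ : Rn n))).toENNReal ∂(sphereMeasure n) :
      ENNReal) : EReal)

end STCone

end

noncomputable section

namespace STCone

/-! Suppose `v ≤ U` off a compact set. Replacing `v` by `max v U`, one may assume `v ≥ U`. On the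
two spheres of radii `t₁ < t₂` bounding a shell around the compact set, `v = U`, so the spherical
averages agree there. The main claim is that the average of `v` is at most that of `U` throughout
the shell. Since `v ≥ U` and the averages are finite, `v = U` then holds a.e. on each centred
sphere, hence Lebesgue-a.e. in the shell. The sub-mean value property of `v` on small spheres about
a point, with upper semicontinuity of `U`, upgrades this to `v ≤ U` at every point
(`le_of_ae_eq_sphere`).

The claim is proved by inserting an explicit radial function between the averages. Transitivity of
the group yields a number `p` with `I - p e eᵀ ∈ ∂F` for all unit `e`
(`exists_rieszCharacteristic`). If `k' (q) = q ^ (-p/2)`, the Hessian of `k (|x|²)` is a positive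
multiple of such a matrix. Choose `α k (t²) + c` equal to the average of `U` at `t₁` and `t₂`;
monotonicity gives `α ≥ 0`. Harmonicity of the average of `U` puts this function below it
(`IsSubharmonic.radial_le`), and the average of `v` lies below this function
(`IsSubharmonic.sphericalAverage_le`).

Viscosity test functions do not pass through integrals, so the last inequality uses mean values
instead. A functional `ℓ` supporting the convex cone `F` at a boundary point (`exists_supporting`)
turns `F`-subharmonic functions into viscosity subsolutions of the linear, possibly degenerate,
inequality `ℓ (D²u) ≥ 0`. This operator has a harmonic measure for the centre of the ball
(`exists_harmonicMeasure`), so `F`-subharmonic functions and their rotations satisfy a mean value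
inequality (`IsLinSub.lintegral_le`). Such inequalities may be integrated over the compact closure
of the group, and the Haar average is the spherical average (`exists_averaging_measure`). -/

/-! ### Calculus of Hessians. -/

theorem eventually_differentiableAt {n : ℕ} {φ : Rn n → ℝ} {x : Rn n} (h : ContDiffAt ℝ 2 φ x) :
    ∀ᶠ y in 𝓝 x, DifferentiableAt ℝ φ y := by
  filter_upwards [h.eventually (by simp)] with y hy
  exact hy.differentiableAt (by simp)

theorem differentiableAt_fderiv {n : ℕ} {φ : Rn n → ℝ} {x : Rn n} (h : ContDiffAt ℝ 2 φ x) :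
    DifferentiableAt ℝ (fderiv ℝ φ) x :=
  (h.fderiv_right (m := 1) (by norm_num)).differentiableAt (by simp)

theorem euclidean_eq_sum {n : ℕ} (u : Rn n) :
    u = ∑ i, u i • EuclideanSpace.single i (1 : ℝ) := by
  ext j
  simp [Finset.sum_apply, Pi.single_apply]

theorem fderiv_fderiv_apply {n : ℕ} (φ : Rn n → ℝ) (x u v : Rn n) :
    fderiv ℝ (fderiv ℝ φ) x u v = ∑ i, ∑ j, u i * v j * hessian φ x i j := by
  conv_lhs => rw [euclidean_eq_sum u, euclidean_eq_sum v]
  simp only [map_sum, map_smul, sum_apply, smul_apply,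
    smul_eq_mul, hessian, Matrix.of_apply, Finset.mul_sum]
  refine (Finset.sum_comm).trans (Finset.sum_congr rfl fun i _ => Finset.sum_congr rfl fun j _ => ?_)
  ring

theorem hessian_isSymm {n : ℕ} {φ : Rn n → ℝ} {x : Rn n} (h : ContDiffAt ℝ 2 φ x) :
    IsSelfAdjoint (hessian φ x) := by
  have := h.isSymmSndFDerivAt (by simp)
  ext i j
  simpa [hessian, Matrix.star_eq_conjTranspose] using this.eq _ _

theorem hessian_add {n : ℕ} {φ ψ : Rn n → ℝ} {x : Rn n} (hφ : ContDiffAt ℝ 2 φ x)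
    (hψ : ContDiffAt ℝ 2 ψ x) : hessian (fun y => φ y + ψ y) x = hessian φ x + hessian ψ x := by
  have : fderiv ℝ (fun y => φ y + ψ y) =ᶠ[𝓝 x] fun y => fderiv ℝ φ y + fderiv ℝ ψ y := by
    filter_upwards [eventually_differentiableAt hφ, eventually_differentiableAt hψ] with y h1 h2
    exact fderiv_fun_add h1 h2
  ext i j
  simp [hessian, this.fderiv_eq, fderiv_fun_add (differentiableAt_fderiv hφ)
    (differentiableAt_fderiv hψ)]

theorem hessian_const {n : ℕ} (c : ℝ) (x : Rn n) : hessian (fun _ => c) x = 0 := by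
  have : fderiv ℝ (fun _ : Rn n => c) = fun _ => 0 := by ext; simp
  ext i j
  simp [hessian, this]

theorem hessian_smul {n : ℕ} {φ : Rn n → ℝ} {x : Rn n} (hφ : ContDiffAt ℝ 2 φ x) (c : ℝ) :
    hessian (fun y => c * φ y) x = c • hessian φ x := by
  have : fderiv ℝ (fun y => c * φ y) =ᶠ[𝓝 x] fun y => c • fderiv ℝ φ y := by
    filter_upwards [eventually_differentiableAt hφ] with y h1
    exact fderiv_const_mul h1 c
  ext i j
  simp [hessian, this.fderiv_eq, fderiv_fun_const_smul (differentiableAt_fderiv hφ)]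

theorem hessian_neg {n : ℕ} {φ : Rn n → ℝ} {x : Rn n} (hφ : ContDiffAt ℝ 2 φ x) :
    hessian (fun y => - φ y) x = - hessian φ x := by
  have := hessian_smul hφ (-1)
  simpa using this

theorem hessian_comp_affine {n : ℕ} {φ : Rn n → ℝ} {b x : Rn n} (M : Matrix (Fin n) (Fin n) ℝ)
    (hφ : ContDiffAt ℝ 2 φ (b + Matrix.toEuclideanLin M x)) :
    hessian (fun y => φ (b + Matrix.toEuclideanLin M y)) x =
      M.transpose * hessian φ (b + Matrix.toEuclideanLin M x) * M := by
  set T : Rn n →L[ℝ] Rn n := LinearMap.toContinuousLinearMap (Matrix.toEuclideanLin M)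
  have hT : ∀ y, HasFDerivAt (fun y => b + T y) T y := fun y =>
    (T.hasFDerivAt).const_add b
  have hcont : ContinuousAt (fun y => b + T y) x := (hT x).continuousAt
  have h1 : fderiv ℝ (fun y => φ (b + T y)) =ᶠ[𝓝 x]
      fun y => (fderiv ℝ φ (b + T y)).comp T := by
    filter_upwards [hcont.eventually (eventually_differentiableAt hφ)] with y hy
    exact (hy.hasFDerivAt.comp y (hT y)).fderiv
  have h2 : HasFDerivAt (fun y => (fderiv ℝ φ (b + T y))) 
      ((fderiv ℝ (fderiv ℝ φ) (b + T x)).comp T) x :=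
    (differentiableAt_fderiv hφ).hasFDerivAt.comp x (hT x)
  have h3 : HasFDerivAt (fun y => (fderiv ℝ φ (b + T y)).comp T) _ x := h2.clm_comp
    (hasFDerivAt_const T x)
  ext i j
  change fderiv ℝ (fderiv ℝ (fun y => φ (b + T y))) x _ _ = _
  rw [h1.fderiv_eq, h3.fderiv]
  have hTi : ∀ i k, (T (EuclideanSpace.single i 1)) k = M k i := by
    intro i k
    simp [T, Matrix.toLpLin_apply, Matrix.toEuclideanLin]
  have := fderiv_fderiv_apply φ (b + T x) (T (EuclideanSpace.single i 1)) 
    (T (EuclideanSpace.single j 1))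
  simp only [hTi] at this
  simp only [ContinuousLinearMap.comp_zero, zero_add,
    ContinuousLinearMap.comp_apply, ContinuousLinearMap.compL_apply,
    ContinuousLinearMap.flip_apply, this]
  simp only [Matrix.mul_apply, Matrix.transpose_apply, Finset.sum_mul]
  rw [Finset.sum_comm]
  refine Finset.sum_congr rfl fun i _ => Finset.sum_congr rfl fun j _ => ?_
  change _ = _ * hessian φ (b + T x) _ _ * _
  ring

theorem hessian_radial {n : ℕ} {K K1 : ℝ → ℝ} {K2 : ℝ} {x : Rn n}
    (h1 : ∀ᶠ q in 𝓝 (‖x‖ ^ 2), HasDerivAt K (K1 q) q) (h2 : HasDerivAt K1 K2 (‖x‖ ^ 2)) :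
    hessian (fun y => K (‖y‖ ^ 2)) x =
      (4 * K2) • Matrix.vecMulVec x x + (2 * K1 (‖x‖ ^ 2)) • 1 := by
  let J : Rn n →L[ℝ] (Rn n →L[ℝ] ℝ) := innerSL ℝ
  have hJ : ∀ u v, J u v = inner ℝ u v := fun u v => innerSL_apply_apply ℝ u v
  have hq : ∀ y : Rn n, HasFDerivAt (fun y : Rn n => ‖y‖ ^ 2) ((2 : ℝ) • J y) y :=
    fun y => by
      rw [show (2 : ℝ) • J y = (2 : ℕ) • J y by simp [two_smul]]
      exact (hasStrictFDerivAt_norm_sq y).hasFDerivAt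
  have hc : ContinuousAt (fun y : Rn n => ‖y‖ ^ 2) x := (hq x).continuousAt
  have e1 : fderiv ℝ (fun y : Rn n => K (‖y‖ ^ 2)) =ᶠ[𝓝 x]
      fun y => K1 (‖y‖ ^ 2) • ((2 : ℝ) • J y) := by
    filter_upwards [hc.eventually h1] with y hy
    exact (hy.comp_hasFDerivAt y (hq y)).fderiv
  have e2 : HasFDerivAt (fun y : Rn n => K1 (‖y‖ ^ 2)) (K2 • ((2 : ℝ) • J x)) x :=
    h2.comp_hasFDerivAt x (hq x)
  have e3 : HasFDerivAt (fun y : Rn n => (2 : ℝ) • J y) ((2 : ℝ) • J) x :=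
    ((2 : ℝ) • J).hasFDerivAt
  have e4 : HasFDerivAt (fun y : Rn n => K1 (‖y‖ ^ 2) • ((2 : ℝ) • J y))
    (K1 (‖x‖ ^ 2) • (2 : ℝ) • J + (K2 • (2 : ℝ) • J x).smulRight ((2 : ℝ) • J x)) x := e2.smul e3
  ext i j
  simp only [hessian, Matrix.of_apply]
  rw [e1.fderiv_eq, e4.fderiv]
  change K1 (‖x‖ ^ 2) * (2 * J (EuclideanSpace.single i (1 : ℝ))
    (EuclideanSpace.single j (1 : ℝ))) + (K2 * (2 * J x (EuclideanSpace.single i (1 : ℝ)))) *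
    (2 * J x (EuclideanSpace.single j (1 : ℝ))) = _
  rw [hJ, hJ, hJ]
  by_cases h : i = j
  · subst h
    simp [Matrix.vecMulVec_apply, EuclideanSpace.inner_single_right]
    ring
  · simp [Matrix.vecMulVec_apply, EuclideanSpace.inner_single_right, h,
      Ne.symm h]
    ring

/-- If the second derivative were positive, the point would also be a local minimum, so `f` would be
locally constant and its second derivative zero. -/
theorem deriv_deriv_nonpos_of_isLocalMax {f : ℝ → ℝ} {t : ℝ} (h : IsLocalMax f t)
    (hc : ContinuousAt f t) : deriv (deriv f) t ≤ 0 := by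
  by_contra! hpos
  have hmin := isLocalMin_of_deriv_deriv_pos hpos h.deriv_eq_zero hc
  have : f =ᶠ[𝓝 t] fun _ => f t := by
    filter_upwards [h, hmin] with s h1 h2 using le_antisymm h1 h2
  have h2 : deriv f =ᶠ[𝓝 t] fun _ => 0 := by
    have := this.deriv
    simpa using this
  rw [h2.deriv_eq] at hpos
  simp at hpos

theorem hessian_neg_posSemidef {n : ℕ} {φ : Rn n → ℝ} {x : Rn n} (hφ : ContDiffAt ℝ 2 φ x)
    (h : IsLocalMax φ x) : (-hessian φ x).PosSemidef := by
  refine Matrix.PosSemidef.of_dotProduct_mulVec_nonneg (hessian_isSymm hφ).neg fun v => ?_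
  set u : Rn n := WithLp.toLp 2 v
  have hl : ∀ t : ℝ, HasDerivAt (fun t : ℝ => x + t • u) u t := fun t => by
    simpa using ((hasDerivAt_id t).smul_const u).const_add x
  have hl0 : ContinuousAt (fun t : ℝ => x + t • u) 0 := (hl 0).continuousAt
  have hx : x + (0 : ℝ) • u = x := by simp
  have h1 : IsLocalMax (fun t : ℝ => φ (x + t • u)) 0 := by
    have : ∀ᶠ y in 𝓝 (x + (0 : ℝ) • u), φ y ≤ φ x := by rw [hx]; exact h
    have := hl0.eventually this
    simpa [IsLocalMax, IsMaxFilter] using this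
  have hev : ∀ᶠ y in 𝓝 (x + (0 : ℝ) • u), DifferentiableAt ℝ φ y := by
    rw [hx]; exact eventually_differentiableAt hφ
  have h2 : deriv (fun t : ℝ => φ (x + t • u)) =ᶠ[𝓝 0] fun t => fderiv ℝ φ (x + t • u) u := by
    filter_upwards [hl0.eventually hev] with t ht
    exact (ht.hasFDerivAt.comp_hasDerivAt t (hl t)).deriv
  have h3 : HasDerivAt (fun t : ℝ => fderiv ℝ φ (x + t • u)) 
      (fderiv ℝ (fderiv ℝ φ) x u) 0 := by
    have := differentiableAt_fderiv hφ
    rw [← hx] at this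
    have h := this.hasFDerivAt.comp_hasDerivAt (0 : ℝ) (hl 0)
    rw [hx] at h
    exact h
  have h4 : HasDerivAt (fun t : ℝ => fderiv ℝ φ (x + t • u) u) 
      (fderiv ℝ (fderiv ℝ φ) x u u) 0 := by
    simpa using h3.clm_apply (hasDerivAt_const (0 : ℝ) u)
  have h5 := deriv_deriv_nonpos_of_isLocalMax h1 (by
    have : ContinuousAt φ (x + (0 : ℝ) • u) := by rw [hx]; exact hφ.continuousAt
    exact ContinuousAt.comp (f := fun t : ℝ => x + t • u) this hl0)
  rw [h2.deriv_eq, h4.deriv, fderiv_fderiv_apply] at h5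
  simp only [Matrix.neg_mulVec, dotProduct_neg, Left.nonneg_neg_iff]
  refine le_trans (le_of_eq ?_) h5
  simp only [dotProduct, Matrix.mulVec, Finset.mul_sum, star_trivial]
  refine Finset.sum_congr rfl fun i _ => Finset.sum_congr rfl fun j _ => ?_
  simp [u]; ring

/-! ### Linear viscosity subsolutions and the maximum principle. -/

/-- Viscosity subsolutions of the linear equation `ℓ (D²u) = 0`. -/
def IsLinSub {n : ℕ} (ℓ : Matrix (Fin n) (Fin n) ℝ →ₗ[ℝ] ℝ) (X : Set (Rn n)) (w : Rn n → EReal) :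
    Prop :=
  ∀ x ∈ X, ∀ φ : Rn n → ℝ, ContDiffAt ℝ 2 φ x →
    (∀ᶠ y in 𝓝 x, w y ≤ (φ y : EReal)) → w x = (φ x : EReal) → 0 ≤ ℓ (hessian φ x)

/-- The contact point maximises `w - φ` over `K`, and `m` is the maximum. It is positive because of
`x₀`, so it cannot be attained off `O`. This supplies the contact points of all the comparison
arguments. -/
theorem exists_touching {n : ℕ} {K O : Set (Rn n)} (hK : IsCompact K)
    {w : Rn n → EReal} (hw : UpperSemicontinuousOn w K) (hlt : ∀ y ∈ K, w y < ⊤)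
    {φ : Rn n → ℝ} (hφ : ContinuousOn φ K) (hbd : ∀ y ∈ K \ O, w y ≤ φ y) {x₀ : Rn n}
    (hx₀ : x₀ ∈ K) (h : (φ x₀ : EReal) < w x₀) :
    ∃ x ∈ K ∩ O, ∃ m : ℝ, 0 < m ∧ w x = (φ x + m : ℝ) ∧ ∀ y ∈ K, w y ≤ (φ y + m : ℝ) := by
  have hcont : UpperSemicontinuousOn (fun y => w y + ((-φ y : ℝ) : EReal)) K := by
    refine hw.add' ?_ ?_
    · exact (continuous_coe_real_ereal.comp_continuousOn hφ.neg).upperSemicontinuousOn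
    · intro y hy
      exact EReal.continuousAt_add (Or.inr (EReal.coe_ne_bot _)) (Or.inr (EReal.coe_ne_top _))
  obtain ⟨x, hxK, hx⟩ := hcont.exists_isMaxOn ⟨x₀, hx₀⟩ hK
  have hmx := hx hx₀
  simp only [Set.mem_ofPred_eq] at hmx
  have hpos : (0 : EReal) < w x₀ + ((-φ x₀ : ℝ) : EReal) := by
    have hb : w x₀ ≠ ⊥ := (lt_of_le_of_lt bot_le h).ne'
    lift w x₀ to ℝ using ⟨(hlt _ hx₀).ne, hb⟩ with r
    norm_cast at h ⊢
    linarith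
  have hpos' := hpos.trans_le hmx
  have hb : w x ≠ ⊥ := by
    rintro hb
    simp [hb] at hpos'
  obtain ⟨r, hr⟩ : ∃ r : ℝ, (r : EReal) = w x := ⟨(w x).toReal, EReal.coe_toReal (hlt _ hxK).ne hb⟩
  rw [← hr] at hpos'
  have hm : 0 < r - φ x := by
    norm_cast at hpos'
  refine ⟨x, ⟨hxK, ?_⟩, r - φ x, hm, by rw [← hr]; congr 1; ring, fun y hy => ?_⟩
  · by_contra hxO
    have := hbd x ⟨hxK, hxO⟩
    rw [← hr] at this
    norm_cast at this
    linarith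
  · have := hx hy
    simp only [Set.mem_ofPred_eq, ← hr] at this
    by_cases hyb : w y = ⊥
    · simp [hyb]
    lift w y to ℝ using ⟨(hlt _ hy).ne, hyb⟩ with s
    norm_cast at this ⊢
    linarith

theorem contDiff_mul_norm_sq {n : ℕ} (c : ℝ) : ContDiff ℝ 2 fun y : Rn n => c * ‖y‖ ^ 2 :=
  contDiff_const.mul (contDiff_norm_sq ℝ)

theorem hessian_mul_norm_sq {n : ℕ} (c : ℝ) (x : Rn n) :
    hessian (fun y => c * ‖y‖ ^ 2) x = (2 * c) • 1 := by
  have := hessian_radial (K := fun q => c * q) (K1 := fun _ => c) (K2 := 0) (x := x)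
    (Filter.Eventually.of_forall fun q => by simpa using (hasDerivAt_id q).const_mul c)
    (hasDerivAt_const _ _)
  simpa using this

theorem contDiff_mul_norm_sub_sq {n : ℕ} (c : ℝ) (b : Rn n) :
    ContDiff ℝ 2 fun y : Rn n => c * ‖y - b‖ ^ 2 :=
  contDiff_const.mul ((contDiff_norm_sq ℝ).comp (contDiff_id.sub contDiff_const))

/-- The supersolution `h` is made strict by adding `ε (1 - |y|²)`, which vanishes on the sphere and
on which the operator takes the value `-2 ε ℓ 1 < 0`. Contact from above at an interior point is
then impossible. Degenerate `ℓ` are covered, since ellipticity enters through `ℓ 1 > 0`. -/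
theorem IsLinSub.le_of_le_on_sphere {n : ℕ} {ℓ : Matrix (Fin n) (Fin n) ℝ →ₗ[ℝ] ℝ} (hI : 0 < ℓ 1)
    {w : Rn n → EReal} (hw : UpperSemicontinuousOn w (Metric.closedBall 0 1))
    (hlt : ∀ y ∈ Metric.closedBall (0 : Rn n) 1, w y < ⊤)
    (hsub : IsLinSub ℓ (Metric.ball 0 1) w) {h : Rn n → ℝ} (hh : ContDiff ℝ 2 h)
    (hL : ∀ x, ℓ (hessian h x) ≤ 0) (hbd : ∀ y ∈ Metric.sphere (0 : Rn n) 1, w y ≤ h y) :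
    ∀ y ∈ Metric.closedBall (0 : Rn n) 1, w y ≤ h y := by
  intro x₀ hx₀
  by_contra! hcon
  obtain ⟨c, hc1, hc2⟩ := EReal.lt_iff_exists_real_btwn.1 hcon
  have hc1' : h x₀ < c := by exact_mod_cast hc1
  set ε := c - h x₀
  have hε : 0 < ε := by simp only [ε]; linarith
  have hC : ContDiff ℝ 2 fun y : Rn n => ε + -ε * ‖y‖ ^ 2 :=
    contDiff_const.add (contDiff_mul_norm_sq _)
  obtain ⟨x, hx, m, -, hxm, hle⟩ := exists_touching (O := Metric.ball 0 1)
    (isCompact_closedBall (0 : Rn n) 1) hw hlt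
    (φ := fun y => h y + (ε + -ε * ‖y‖ ^ 2)) (hh.add hC).continuous.continuousOn
    (by
      intro y hy
      have hy' : ‖y‖ = 1 := by
        have h1 := hy.1
        have h2 := hy.2
        simp only [Metric.mem_closedBall, dist_zero_right, Metric.mem_ball, not_lt] at h1 h2
        exact le_antisymm h1 h2
      have := hbd y (by simpa using hy')
      simpa [hy'] using this) hx₀
    (by
      refine lt_of_le_of_lt ?_ hc2
      norm_cast
      have : 0 ≤ ε * ‖x₀‖ ^ 2 := by positivity
      simp only [ε] at this ⊢
      linarith)
  have hC' : ContDiff ℝ 2 fun y : Rn n => (ε + m) + -ε * ‖y‖ ^ 2 :=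
    contDiff_const.add (contDiff_mul_norm_sq _)
  have h1 := hsub x hx.2 (fun y => h y + ((ε + m) + -ε * ‖y‖ ^ 2)) (hh.add hC').contDiffAt
    (by
      filter_upwards [Metric.isOpen_ball.mem_nhds hx.2] with y hy
      refine (hle y (Metric.ball_subset_closedBall hy)).trans (le_of_eq ?_)
      congr 1; ring)
    (by rw [hxm]; congr 1; ring)
  rw [hessian_add hh.contDiffAt hC'.contDiffAt, hessian_add contDiffAt_const
    (contDiff_mul_norm_sq _).contDiffAt, hessian_const, hessian_mul_norm_sq] at h1
  simp only [zero_add, map_add, map_smul, smul_eq_mul] at h1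
  have := hL x
  nlinarith

theorem isLinSub_of_contDiff {n : ℕ} {ℓ : Matrix (Fin n) (Fin n) ℝ →ₗ[ℝ] ℝ}
    (hP : ∀ P : Matrix (Fin n) (Fin n) ℝ, P.PosSemidef → 0 ≤ ℓ P) {X : Set (Rn n)}
    {u : Rn n → ℝ} (hu : ∀ x ∈ X, ContDiffAt ℝ 2 u x) (hL : ∀ x ∈ X, 0 ≤ ℓ (hessian u x)) :
    IsLinSub ℓ X fun y => (u y : EReal) := by
  intro x hx φ hφ hle heq
  have hd : ContDiffAt ℝ 2 (fun y => u y + -φ y) x := (hu x hx).add hφ.neg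
  have hmax : IsLocalMax (fun y => u y + -φ y) x := by
    filter_upwards [hle] with y hy
    have hy' : u y ≤ φ y := by exact_mod_cast hy
    have heq' : u x = φ x := EReal.coe_injective heq
    linarith
  have h1 := hP _ (hessian_neg_posSemidef hd hmax)
  rw [hessian_add (hu x hx) hφ.neg, hessian_neg hφ] at h1
  simp only [map_neg, map_add] at h1
  linarith [hL x hx]

/-- A steep paraboloid touches `w` from above somewhere, and its Hessian there is an element of `P`.
Used for `F` and for its dual, this excludes `F = ∅` and `F = univ`. -/
theorem IsSubharmonic.nonempty_of_ne_bot {n : ℕ} {P : Set (SymMat n)} {X : Set (Rn n)}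
    (hX : IsOpen X) {w : Rn n → EReal} (hw : IsSubharmonic P X w) {x₀ : Rn n} (hx₀ : x₀ ∈ X)
    (hb : w x₀ ≠ ⊥) : P.Nonempty := by
  obtain ⟨r, hr, hrX⟩ := Metric.nhds_basis_closedBall.mem_iff.1 (hX.mem_nhds hx₀)
  have hK := isCompact_closedBall x₀ r
  have husc := hw.usc.mono hrX
  obtain ⟨z, hz, hzmax⟩ := husc.exists_isMaxOn ⟨x₀, Metric.mem_closedBall_self hr.le⟩ hK
  obtain ⟨s, hs⟩ : ∃ s : ℝ, (s : EReal) = w x₀ :=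
    ⟨(w x₀).toReal, EReal.coe_toReal (hw.lt_top _ hx₀).ne hb⟩
  obtain ⟨M, hM⟩ : ∃ M : ℝ, (M : EReal) = w z := by
    refine ⟨(w z).toReal, EReal.coe_toReal (hw.lt_top _ (hrX hz)).ne ?_⟩
    have := hzmax (Metric.mem_closedBall_self hr.le)
    rintro h
    simp only [Set.mem_ofPred_eq, h, le_bot_iff] at this
    exact hb this
  have hsM : s ≤ M := by
    have := hzmax (Metric.mem_closedBall_self hr.le)
    simp only [Set.mem_ofPred_eq, ← hM, ← hs] at this
    exact_mod_cast this
  -- With this `c`, the paraboloid `s - 1 + c |y - x₀|²` equals the maximum `M` on the boundary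
  -- sphere and lies one below `w` at the centre.
  set c := (M - s + 1) / r ^ 2
  have hC : ∀ t : ℝ, ContDiff ℝ 2 fun y : Rn n => t + c * ‖y - x₀‖ ^ 2 := fun t =>
    contDiff_const.add (contDiff_mul_norm_sub_sq _ _)
  obtain ⟨x, hx, m, -, hxm, hle⟩ := exists_touching (O := Metric.ball x₀ r) hK husc
    (fun y hy => hw.lt_top y (hrX hy)) (hC (s - 1)).continuous.continuousOn
    (by
      intro y hy
      have hy' : ‖y - x₀‖ = r := by
        have h1 := hy.1
        have h2 := hy.2
        simp only [Metric.mem_closedBall, dist_eq_norm, Metric.mem_ball, not_lt] at h1 h2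
        exact le_antisymm h1 h2
      have := hzmax hy.1
      simp only [Set.mem_ofPred_eq, ← hM] at this
      refine this.trans ?_
      norm_cast
      rw [hy']
      simp only [c]
      field_simp
      linarith) (Metric.mem_closedBall_self hr.le)
    (by rw [← hs]; norm_cast; simp)
  obtain ⟨A, hA, -⟩ := hw.viscosity x (hrX hx.1) (fun y => (s - 1 + m) + c * ‖y - x₀‖ ^ 2)
    (hC _).contDiffAt
    (by
      filter_upwards [Metric.isOpen_ball.mem_nhds hx.2] with y hy
      refine (hle y (Metric.ball_subset_closedBall hy)).trans (le_of_eq ?_)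
      congr 1; ring)
    (by rw [hxm]; congr 1; ring)
  exact ⟨A, hA⟩

/-! ### The polynomial Dirichlet problem on the unit ball. -/

/-- A polynomial as a function on `ℝⁿ`. -/
def polyFun {n : ℕ} (p : MvPolynomial (Fin n) ℝ) (x : Rn n) : ℝ := MvPolynomial.eval x.ofLp p

theorem contDiff_polyFun {n : ℕ} (p : MvPolynomial (Fin n) ℝ) {m : WithTop ℕ∞} :
    ContDiff ℝ m (polyFun p) := by
  unfold polyFun
  induction p using MvPolynomial.induction_on with
  | C a => simpa using contDiff_const
  | add p q hp hq => simpa using hp.add hq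
  | mul_X p i hp =>
    have : ContDiff ℝ m fun x : Rn n => x i := contDiff_euclidean.1 contDiff_id i
    simpa using hp.mul this

theorem fderiv_polyFun {n : ℕ} (p : MvPolynomial (Fin n) ℝ) (x : Rn n) (j : Fin n) :
    fderiv ℝ (polyFun p) x (EuclideanSpace.single j 1) = polyFun (MvPolynomial.pderiv j p) x := by
  have hd : ∀ q : MvPolynomial (Fin n) ℝ, DifferentiableAt ℝ (polyFun q) x := fun q =>
    ((contDiff_polyFun q (m := 1)).differentiable (by simp)) x
  induction p using MvPolynomial.induction_on with
  | C a =>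
    have : polyFun (MvPolynomial.C a : MvPolynomial (Fin n) ℝ) = fun _ => a := by
      ext; simp [polyFun]
    rw [this]
    simp [polyFun]
  | add p q hp hq =>
    have : polyFun (p + q) = fun y => polyFun p y + polyFun q y := by ext; simp [polyFun]
    rw [this, fderiv_fun_add (hd p) (hd q)]
    simp [hp, hq, polyFun]
  | mul_X p i hp =>
    have : polyFun (p * MvPolynomial.X i) = fun y => polyFun p y * y i := by ext; simp [polyFun]
    have hi : HasFDerivAt (fun y : Rn n => y i) (EuclideanSpace.proj i : Rn n →L[ℝ] ℝ) x :=
      (EuclideanSpace.proj i : Rn n →L[ℝ] ℝ).hasFDerivAt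
    rw [this, fderiv_fun_mul (hd p) hi.differentiableAt, hi.fderiv]
    by_cases h : i = j
    · subst h
      simp [hp, polyFun, MvPolynomial.pderiv_X]
    · simp [hp, polyFun, MvPolynomial.pderiv_X, h]

theorem hessian_polyFun {n : ℕ} (p : MvPolynomial (Fin n) ℝ) (x : Rn n) (i j : Fin n) :
    hessian (polyFun p) x i j = polyFun (MvPolynomial.pderiv i (MvPolynomial.pderiv j p)) x := by
  rw [← fderiv_polyFun]
  have : polyFun (MvPolynomial.pderiv j p) =
      fun y => fderiv ℝ (polyFun p) y (EuclideanSpace.single j 1) := by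
    ext y; rw [fderiv_polyFun]
  rw [this]
  have h := ((differentiableAt_fderiv (x := x) (contDiff_polyFun p).contDiffAt).hasFDerivAt).clm_apply
    (hasFDerivAt_const (EuclideanSpace.single j (1 : ℝ)) x)
  rw [h.fderiv]
  simp [hessian]

theorem linearMap_matrix_apply {n : ℕ} (ℓ : Matrix (Fin n) (Fin n) ℝ →ₗ[ℝ] ℝ)
    (A : Matrix (Fin n) (Fin n) ℝ) :
    ℓ A = ∑ i, ∑ j, ℓ (Matrix.single i j 1) * A i j := by
  conv_lhs => rw [Matrix.matrix_eq_sum_single A]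
  simp only [map_sum]
  refine Finset.sum_congr rfl fun i _ => Finset.sum_congr rfl fun j _ => ?_
  have : Matrix.single i j (A i j) = A i j • Matrix.single i j (1 : ℝ) := by
    rw [Matrix.smul_single]; simp
  rw [this, map_smul, smul_eq_mul, mul_comm]

/-- The constant coefficient operator `p ↦ ℓ (D²p)` on polynomials. -/
def polyOp {n : ℕ} (ℓ : Matrix (Fin n) (Fin n) ℝ →ₗ[ℝ] ℝ) :
    MvPolynomial (Fin n) ℝ →ₗ[ℝ] MvPolynomial (Fin n) ℝ :=
  ∑ i, ∑ j, ℓ (Matrix.single i j 1) •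
    ((MvPolynomial.pderiv i).toLinearMap ∘ₗ (MvPolynomial.pderiv j).toLinearMap)

theorem polyFun_polyOp {n : ℕ} (ℓ : Matrix (Fin n) (Fin n) ℝ →ₗ[ℝ] ℝ)
    (p : MvPolynomial (Fin n) ℝ) (x : Rn n) :
    polyFun (polyOp ℓ p) x = ℓ (hessian (polyFun p) x) := by
  rw [linearMap_matrix_apply]
  simp only [hessian_polyFun]
  simp [polyOp, polyFun, MvPolynomial.smul_eval]

theorem pderiv_mem_restrictTotalDegree {n k : ℕ} (i : Fin n) {p : MvPolynomial (Fin n) ℝ}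
    (hp : p ∈ MvPolynomial.restrictTotalDegree (Fin n) ℝ (k + 1)) :
    MvPolynomial.pderiv i p ∈ MvPolynomial.restrictTotalDegree (Fin n) ℝ k := by
  rw [MvPolynomial.mem_restrictTotalDegree] at hp
  rw [p.as_sum, map_sum]
  refine Submodule.sum_mem _ fun s hs => ?_
  rw [MvPolynomial.mem_restrictTotalDegree, MvPolynomial.pderiv_monomial]
  by_cases hsi : s i = 0
  · simp [hsi]
  refine (MvPolynomial.totalDegree_monomial_le _ _).trans ?_
  have h1 := (MvPolynomial.le_totalDegree hs).trans hp
  have h2 : s = (s - Finsupp.single i 1) + Finsupp.single i 1 := by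
    ext j
    by_cases h : i = j
    · subst h; simp; omega
    · simp [h]
  rw [h2, Finsupp.sum_add_index' (by simp) (by simp)] at h1
  simp only [Finsupp.sum_single_index] at h1
  change ((s - Finsupp.single i 1).sum fun _ e => e) ≤ k
  omega

theorem polyOp_mem_restrictTotalDegree {n k : ℕ} (ℓ : Matrix (Fin n) (Fin n) ℝ →ₗ[ℝ] ℝ)
    {p : MvPolynomial (Fin n) ℝ}
    (hp : p ∈ MvPolynomial.restrictTotalDegree (Fin n) ℝ (k + 2)) :
    polyOp ℓ p ∈ MvPolynomial.restrictTotalDegree (Fin n) ℝ k := by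
  simp only [polyOp, LinearMap.sum_apply, LinearMap.smul_apply]
  exact Submodule.sum_mem _ fun i _ => Submodule.sum_mem _ fun j _ => Submodule.smul_mem _ _
    (pderiv_mem_restrictTotalDegree i (pderiv_mem_restrictTotalDegree j hp))

/-- The polynomial `1 - |x|²`. -/
def ballPoly (n : ℕ) : MvPolynomial (Fin n) ℝ := 1 - ∑ i, MvPolynomial.X i ^ 2

theorem polyFun_ballPoly {n : ℕ} (x : Rn n) : polyFun (ballPoly n) x = 1 - ‖x‖ ^ 2 := by
  simp [polyFun, ballPoly, EuclideanSpace.norm_sq_eq]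

theorem totalDegree_ballPoly_le (n : ℕ) : (ballPoly n).totalDegree ≤ 2 := by
  refine (MvPolynomial.totalDegree_sub _ _).trans (max_le (by simp) ?_)
  refine MvPolynomial.totalDegree_finsetSum_le fun i _ => ?_
  exact (MvPolynomial.totalDegree_pow _ _).trans (by simp)

theorem polyFun_le_of_sphere {n : ℕ} {ℓ : Matrix (Fin n) (Fin n) ℝ →ₗ[ℝ] ℝ}
    (hI : 0 < ℓ 1) (hP : ∀ P : Matrix (Fin n) (Fin n) ℝ, P.PosSemidef → 0 ≤ ℓ P)
    {H : MvPolynomial (Fin n) ℝ} (hH : polyOp ℓ H = 0)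
    {c : ℝ} (h0 : ∀ x ∈ Metric.sphere (0 : Rn n) 1, polyFun H x ≤ c) :
    ∀ x ∈ Metric.closedBall (0 : Rn n) 1, polyFun H x ≤ c := by
  intro x hx
  have hz : ∀ x, ℓ (hessian (polyFun H) x) = 0 := fun x => by
    rw [← polyFun_polyOp, hH]; simp [polyFun]
  have h1 : IsLinSub ℓ (Metric.ball 0 1) fun y => (polyFun H y : EReal) :=
    isLinSub_of_contDiff hP (fun x _ => (contDiff_polyFun H).contDiffAt) fun x _ => (hz x).ge
  have h2 := IsLinSub.le_of_le_on_sphere (w := fun y => (polyFun H y : EReal)) hI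
    (UpperSemicontinuous.upperSemicontinuousOn (continuous_coe_real_ereal.comp
      (contDiff_polyFun H (m := 0)).continuous).upperSemicontinuous _)
    (fun y _ => EReal.coe_lt_top _) h1 (h := fun _ => c) contDiff_const
    (fun x => by simp [hessian_const]) (fun y hy => by exact_mod_cast h0 y hy) x hx
  exact_mod_cast h2

theorem eq_zero_of_polyFun_ball {n : ℕ} {q : MvPolynomial (Fin n) ℝ}
    (h : ∀ x ∈ Metric.ball (0 : Rn n) 1, polyFun q x = 0) : q = 0 := by
  -- On this cube each `x i ^ 2 ≤ 1 / (n + 1)`, so `|x|² ≤ n / (n + 1) < 1`: it lies in the ball,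
  -- also when `n = 0`.
  refine MvPolynomial.funext_set (fun _ => Set.Ioo (-(1 / (n + 1 : ℝ))) (1 / (n + 1)))
    (fun _ => Set.Ioo_infinite (by have : (0 : ℝ) < 1 / (n + 1) := by positivity
                                   linarith)) fun x hx => ?_
  have := h (WithLp.toLp 2 x) ?_
  · simpa [polyFun] using this
  rw [mem_ball_zero_iff, ← sq_lt_one_iff₀ (norm_nonneg _), EuclideanSpace.norm_sq_eq]
  have hb : ∀ i ∈ Finset.univ, ‖x i‖ ^ 2 ≤ 1 / (n + 1 : ℝ) := by
    intro i _
    have hi := hx i (Set.mem_univ _)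
    have h1 : |x i| ≤ 1 / (n + 1 : ℝ) := abs_le.2 ⟨hi.1.le, hi.2.le⟩
    have h2 : 1 / (n + 1 : ℝ) ≤ 1 := by
      rw [div_le_one (by positivity)]
      have : (0 : ℝ) ≤ n := by positivity
      linarith
    rw [Real.norm_eq_abs]
    nlinarith [abs_nonneg (x i)]
  refine (Finset.sum_le_sum hb).trans_lt ?_
  simp only [Finset.sum_const, Finset.card_univ, Fintype.card_fin, nsmul_eq_mul]
  rw [mul_one_div, div_lt_one (by positivity)]
  linarith

/-- Seek `H = p - (1 - |x|²) q`, so that `q ↦ ℓ (D²((1 - |x|²) q))` must attain the value `ℓ (D²p)`.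
Multiplication raises the degree by at most two and the operator lowers it by two, so this is an
endomorphism of the polynomials of degree at most that of `p`. The maximum principle makes it
injective, and finite dimension makes it surjective. -/
theorem exists_harmonic_eq_on_sphere {n : ℕ} {ℓ : Matrix (Fin n) (Fin n) ℝ →ₗ[ℝ] ℝ}
    (hI : 0 < ℓ 1) (hP : ∀ P : Matrix (Fin n) (Fin n) ℝ, P.PosSemidef → 0 ≤ ℓ P)
    (p : MvPolynomial (Fin n) ℝ) :
    ∃ H, polyOp ℓ H = 0 ∧ ∀ x ∈ Metric.sphere (0 : Rn n) 1, polyFun H x = polyFun p x := by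
  set k := p.totalDegree
  set V := MvPolynomial.restrictTotalDegree (Fin n) ℝ k
  have hmaps : ∀ q ∈ V, polyOp ℓ (ballPoly n * q) ∈ V := by
    intro q hq
    refine polyOp_mem_restrictTotalDegree ℓ ?_
    rw [MvPolynomial.mem_restrictTotalDegree] at hq ⊢
    refine (MvPolynomial.totalDegree_mul _ _).trans ?_
    have := totalDegree_ballPoly_le n
    omega
  let T : V →ₗ[ℝ] V := ((polyOp ℓ ∘ₗ LinearMap.mulLeft ℝ (ballPoly n)).restrict hmaps)
  have hinj : Function.Injective T := by
    rw [← LinearMap.ker_eq_bot, LinearMap.ker_eq_bot']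
    rintro ⟨q, hq⟩ hTq
    have h0 : polyOp ℓ (ballPoly n * q) = 0 := congrArg Subtype.val hTq
    have h0' : polyOp ℓ (-(ballPoly n * q)) = 0 := by rw [map_neg, h0, neg_zero]
    have hs : ∀ x ∈ Metric.sphere (0 : Rn n) 1, polyFun (ballPoly n * q) x = 0 := by
      intro x hx
      have : polyFun (ballPoly n * q) x = polyFun (ballPoly n) x * polyFun q x := by simp [polyFun]
      rw [this, polyFun_ballPoly, mem_sphere_zero_iff_norm.1 hx]; simp
    have hneg : ∀ r : MvPolynomial (Fin n) ℝ, ∀ x : Rn n, polyFun (-r) x = - polyFun r x := by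
      intro r x; simp [polyFun]
    have h1 := polyFun_le_of_sphere hI hP h0 (fun x hx => (hs x hx).le)
    have h2 := polyFun_le_of_sphere hI hP h0' (c := 0) (fun x hx => by
      rw [hneg, hs x hx, neg_zero])
    have hq0 : q = 0 := by
      refine eq_zero_of_polyFun_ball fun x hx => ?_
      have hxc := Metric.ball_subset_closedBall hx
      have h3 : polyFun (ballPoly n * q) x = 0 := by
        refine le_antisymm (h1 x hxc) ?_
        have := h2 x hxc
        rw [hneg] at this
        linarith
      have h4 : polyFun (ballPoly n * q) x = polyFun (ballPoly n) x * polyFun q x := by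
        simp [polyFun]
      rw [h4, polyFun_ballPoly] at h3
      rw [mem_ball_zero_iff] at hx
      have : 1 - ‖x‖ ^ 2 ≠ 0 := by nlinarith [norm_nonneg x]
      exact (mul_eq_zero.1 h3).resolve_left this
    exact Subtype.ext hq0
  have hsurj := LinearMap.injective_iff_surjective.1 hinj
  have hLp : polyOp ℓ p ∈ V := polyOp_mem_restrictTotalDegree ℓ (by
    rw [MvPolynomial.mem_restrictTotalDegree]; omega)
  obtain ⟨⟨q, hq⟩, hTq⟩ := hsurj ⟨polyOp ℓ p, hLp⟩
  have hTq' : polyOp ℓ (ballPoly n * q) = polyOp ℓ p := congrArg Subtype.val hTq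
  refine ⟨p - ballPoly n * q, by rw [map_sub, hTq', sub_self], fun x hx => ?_⟩
  have : polyFun (p - ballPoly n * q) x = polyFun p x - polyFun (ballPoly n) x * polyFun q x := by
    simp [polyFun]
  rw [this, polyFun_ballPoly, mem_sphere_zero_iff_norm.1 hx]
  simp

/-! ### Harmonic measure of a linear operator at the centre of the ball. -/

/-- Truncating `D` at height `k` and taking the infimal convolution with `k * dist` gives
nonnegative Lipschitz functions below `D`. By lower semicontinuity their lower limit is at least
`D`, and Fatou's lemma concludes. -/
theorem lintegral_le_of_forall_continuous_le {S : Type*} [PseudoMetricSpace S] [MeasurableSpace S]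
    [BorelSpace S] [Nonempty S] {μ : Measure S} {D : S → ENNReal} (hD : LowerSemicontinuous D)
    {c : ENNReal}
    (h : ∀ d : C(S, ℝ), (∀ σ, 0 ≤ d σ) → (∀ σ, ENNReal.ofReal (d σ) ≤ D σ) →
      ∫⁻ σ, ENNReal.ofReal (d σ) ∂μ ≤ c) :
    ∫⁻ σ, D σ ∂μ ≤ c := by
  set m : ℕ → S → ℝ := fun k τ => (min (D τ) k).toReal
  have hm0 : ∀ k τ, 0 ≤ m k τ := fun k τ => ENNReal.toReal_nonneg
  have hmD : ∀ k τ, ENNReal.ofReal (m k τ) = min (D τ) k := fun k τ =>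
    ENNReal.ofReal_toReal ((min_le_right _ _).trans_lt (ENNReal.natCast_lt_top k)).ne
  set d : ℕ → S → ℝ := fun k σ => ⨅ τ, (m k τ + k * dist σ τ)
  have hbdd : ∀ k σ, BddBelow (Set.range fun τ => m k τ + k * dist σ τ) := fun k σ =>
    ⟨0, by rintro _ ⟨τ, rfl⟩; have := hm0 k τ; positivity⟩
  have hd0 : ∀ k σ, 0 ≤ d k σ := fun k σ => le_ciInf fun τ => by have := hm0 k τ; positivity
  have hdm : ∀ k σ, d k σ ≤ m k σ := fun k σ => by
    refine (ciInf_le (hbdd k σ) σ).trans ?_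
    simp
  have hlip : ∀ k : ℕ, LipschitzWith (k : NNReal) (d k) := fun k => by
    refine LipschitzWith.of_le_add_mul _ fun x y => ?_
    rw [← sub_le_iff_le_add]
    refine le_ciInf fun τ => ?_
    rw [sub_le_iff_le_add]
    refine (ciInf_le (hbdd k x) τ).trans ?_
    have h1 := dist_triangle x y τ
    have h2 : (0 : ℝ) ≤ k := by positivity
    rw [NNReal.coe_natCast]
    nlinarith
  have hle : ∀ k, ∫⁻ σ, ENNReal.ofReal (d k σ) ∂μ ≤ c := fun k => by
    refine h ⟨d k, (hlip k).continuous⟩ (hd0 k) fun σ => ?_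
    refine (ENNReal.ofReal_le_ofReal (hdm k σ)).trans ?_
    rw [hmD]
    exact min_le_left _ _
  have hlim : ∀ σ, D σ ≤ Filter.liminf (fun k => ENNReal.ofReal (d k σ)) Filter.atTop := by
    intro σ
    refine le_of_forall_lt fun a ha => ?_
    obtain ⟨b, hab, hbD⟩ := ENNReal.lt_iff_exists_real_btwn.1 ha |>.imp fun b hb => hb.2
    refine hab.trans_le ?_
    have hnhds := hD σ _ hbD
    obtain ⟨δ, hδ, hball⟩ := Metric.eventually_nhds_iff.1 hnhds
    refine Filter.le_liminf_of_le (by isBoundedDefault) ?_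
    -- For `τ` within `δ` of `σ`, `k ≥ b` keeps the truncation above `b`; for the other `τ`, `k ≥ b
    -- / δ` makes the distance penalty at least `b`.
    obtain ⟨N, hN⟩ := exists_nat_ge (max b (b / δ))
    filter_upwards [Filter.eventually_ge_atTop N] with k hk
    refine ENNReal.ofReal_le_ofReal (le_ciInf fun τ => ?_)
    have hkN : (N : ℝ) ≤ k := by exact_mod_cast hk
    by_cases hτ : dist τ σ < δ
    · have h1 := hball hτ
      have h2 : ENNReal.ofReal b ≤ ENNReal.ofReal (m k τ) := by
        rw [hmD]
        refine le_min h1.le ?_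
        rw [ENNReal.ofReal_le_iff_le_toReal (ENNReal.natCast_ne_top k)]
        simpa using (le_max_left _ _).trans (hN.trans hkN)
      have h3 := (ENNReal.ofReal_le_ofReal_iff (hm0 k τ)).1 h2
      have : (0 : ℝ) ≤ k * dist σ τ := by positivity
      linarith
    · rw [not_lt, dist_comm] at hτ
      have h1 : b / δ ≤ k := (le_max_right _ _).trans (hN.trans hkN)
      rw [div_le_iff₀ hδ] at h1
      have h2 : (k : ℝ) * δ ≤ k * dist σ τ := by gcongr
      linarith [hm0 k τ]
  calc ∫⁻ σ, D σ ∂μ ≤ ∫⁻ σ, Filter.liminf (fun k => ENNReal.ofReal (d k σ)) Filter.atTop ∂μ :=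
        lintegral_mono hlim
    _ ≤ Filter.liminf (fun k => ∫⁻ σ, ENNReal.ofReal (d k σ) ∂μ) Filter.atTop :=
        lintegral_liminf_le fun k => (hlip k).continuous.measurable.ennreal_ofReal
    _ ≤ c := by
        refine Filter.liminf_le_of_le (by isBoundedDefault) fun b hb => ?_
        obtain ⟨k, hk⟩ := hb.exists
        exact hk.trans (hle k)

abbrev unitSphere (n : ℕ) : Type := Metric.sphere (0 : Rn n) 1

/-- Restriction of polynomials to the unit sphere. -/
def polySphere (n : ℕ) : MvPolynomial (Fin n) ℝ →ₐ[ℝ] C(unitSphere n, ℝ) :=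
  MvPolynomial.aeval fun i => ⟨fun σ => (σ : Rn n) i, by fun_prop⟩

theorem polySphere_apply {n : ℕ} (p : MvPolynomial (Fin n) ℝ) (σ : unitSphere n) :
    polySphere n p σ = polyFun p σ := by
  unfold polySphere polyFun
  induction p using MvPolynomial.induction_on with
  | C a => simp
  | add p q hp hq => simp [hp, hq]
  | mul_X p i hp => simp [hp]

theorem exists_polyFun_near {n : ℕ} (d : C(unitSphere n, ℝ)) {ε : ℝ} (hε : 0 < ε) :
    ∃ p : MvPolynomial (Fin n) ℝ, ∀ σ : unitSphere n, |polyFun p σ - d σ| < ε := by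
  have hsep : (polySphere n).range.SeparatesPoints := by
    intro x y hxy
    have : ∃ i, (x : Rn n) i ≠ (y : Rn n) i := by
      by_contra! h
      exact hxy (Subtype.ext (PiLp.ext h))
    obtain ⟨i, hi⟩ := this
    refine ⟨_, ⟨polySphere n (MvPolynomial.X i), ⟨_, rfl⟩, rfl⟩, ?_⟩
    simpa [polySphere_apply, polyFun] using hi
  obtain ⟨⟨_, ⟨p, rfl⟩⟩, hp⟩ :=
    ContinuousMap.exists_mem_subalgebra_near_continuousMap_of_separatesPoints _ hsep d ε hε
  refine ⟨p, fun σ => ?_⟩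
  have := (ContinuousMap.norm_lt_iff _ hε).1 hp σ
  simpa [polySphere_apply] using this

/-- By the maximum principle, the value at `0` of a polynomial solution is determined by its
restriction to the sphere and bounded by the sup norm there. Hahn–Banach extends it to a functional
on `C(S)` bounded by the norm and equal to `1` at the constant `1`. Such a functional is positive,
so Riesz–Markov represents it by a probability measure. -/
theorem exists_harmonicMeasure {n : ℕ} [Nonempty (unitSphere n)]
    {ℓ : Matrix (Fin n) (Fin n) ℝ →ₗ[ℝ] ℝ}
    (hI : 0 < ℓ 1) (hP : ∀ P : Matrix (Fin n) (Fin n) ℝ, P.PosSemidef → 0 ≤ ℓ P) :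
    ∃ μ : Measure (unitSphere n), IsProbabilityMeasure μ ∧
      ∀ H, polyOp ℓ H = 0 → ∫ σ : unitSphere n, polyFun H σ ∂μ = polyFun H 0 := by
  set V := LinearMap.ker (polyOp ℓ)
  let R : V →ₗ[ℝ] C(unitSphere n, ℝ) := (polySphere n).toLinearMap ∘ₗ V.subtype
  have hR : ∀ (H : V) (σ : unitSphere n), R H σ = polyFun H.1 σ := fun H σ =>
    polySphere_apply H.1 σ
  -- A linear choice of solution for each boundary value; that the value at `0` does not depend on
  -- the choice is checked in `hΛR`.
  obtain ⟨s, hs⟩ := LinearMap.exists_rightInverse_of_surjective R.rangeRestrict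
    R.range_rangeRestrict
  have hsR : ∀ g : LinearMap.range R, R (s g) = g := fun g => by
    have := LinearMap.congr_fun hs g
    exact congrArg Subtype.val this
  let ev : V →ₗ[ℝ] ℝ := (MvPolynomial.aeval (fun _ : Fin n => (0 : ℝ))).toLinearMap ∘ₗ V.subtype
  have hev : ∀ H : V, ev H = polyFun H.1 0 := fun H => by
    simp only [ev, polyFun, LinearMap.comp_apply, Submodule.subtype_apply,
      AlgHom.toLinearMap_apply, MvPolynomial.aeval_eq_eval]
    rfl
  have hmax : ∀ (H : V) (c : ℝ), (∀ σ, R H σ ≤ c) → ev H ≤ c := fun H c hc => by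
    rw [hev]
    refine polyFun_le_of_sphere hI hP H.2 (fun x hx => ?_) 0 (by simp)
    rw [← hR H ⟨x, hx⟩]
    exact hc _
  obtain ⟨Λ, hΛ, hΛn⟩ := exists_extension_of_le_sublinear ⟨LinearMap.range R, ev ∘ₗ s⟩
    (fun g => ‖g‖) (fun c hc x => by simp [norm_smul, abs_of_pos hc]) (fun x y => norm_add_le x y)
    (fun g => by
      refine hmax (s g) _ fun σ => ?_
      rw [hsR]
      exact (le_abs_self _).trans (g.1.norm_coe_le_norm σ))
  have hΛR : ∀ H : V, Λ (R H) = ev H := fun H => by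
    have h1 := hΛ ⟨R H, ⟨H, rfl⟩⟩
    rw [h1]
    change ev (s _) = ev H
    set H' := s ⟨R H, ⟨H, rfl⟩⟩
    have hH' : R H' = R H := hsR _
    have h2 := hmax (H' - H) 0 (fun σ => by simp [hH'])
    have h3 := hmax (H - H') 0 (fun σ => by simp [hH'])
    rw [map_sub] at h2 h3
    linarith
  have h1V : (1 : MvPolynomial (Fin n) ℝ) ∈ V := by
    simp [V, polyOp]
  have hΛ1 : Λ 1 = 1 := by
    have h1 := hΛR ⟨1, h1V⟩
    have h2 : R ⟨1, h1V⟩ = 1 := by ext σ; rw [hR]; simp [polyFun]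
    rw [h2, hev] at h1
    rw [h1]; simp [polyFun]
  have hpos : ∀ g : C(unitSphere n, ℝ), 0 ≤ g → 0 ≤ Λ g := fun g hg => by
    -- Since `0 ≤ ‖g‖ - g ≤ ‖g‖`, the norm bound reads `‖g‖ - Λ g ≤ ‖g‖`.
    have h1 := hΛn (‖g‖ • (1 : C(unitSphere n, ℝ)) - g)
    have h2 : ‖‖g‖ • (1 : C(unitSphere n, ℝ)) - g‖ ≤ ‖g‖ := by
      rw [ContinuousMap.norm_le _ (norm_nonneg _)]
      intro σ
      have h3 := (le_abs_self _).trans (g.norm_coe_le_norm σ)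
      have h4 : 0 ≤ g σ := hg σ
      simp only [ContinuousMap.sub_apply, ContinuousMap.smul_apply, ContinuousMap.one_apply,
        smul_eq_mul, mul_one, Real.norm_eq_abs]
      rw [abs_le]
      constructor <;> linarith [norm_nonneg g]
    have h5 := h1.trans h2
    rw [map_sub, map_smul, hΛ1, smul_eq_mul, mul_one] at h5
    linarith
  let Ψ : CompactlySupportedContinuousMap (unitSphere n) ℝ →ₚ[ℝ] ℝ :=
    { toFun := fun g => Λ g.toContinuousMap
      map_add' := fun f g => by
        rw [← map_add]; rfl
      map_smul' := fun c g => by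
        rw [RingHom.id_apply, ← map_smul]; rfl
      monotone' := fun f g hfg => by
        have := hpos (g.toContinuousMap - f.toContinuousMap) (fun σ => by
          simpa using hfg σ)
        rw [map_sub] at this
        change Λ f.toContinuousMap ≤ Λ g.toContinuousMap
        linarith }
  have hint : ∀ g : C(unitSphere n, ℝ), ∫ σ, g σ ∂(RealRMK.rieszMeasure Ψ) = Λ g := fun g => by
    have := RealRMK.integral_rieszMeasure Ψ
      ⟨g, HasCompactSupport.of_compactSpace _⟩
    exact this
  refine ⟨RealRMK.rieszMeasure Ψ, ⟨?_⟩, fun H hH => ?_⟩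
  · have := hint 1
    simp only [ContinuousMap.one_apply, integral_const, smul_eq_mul, mul_one, hΛ1] at this
    rw [measureReal_def, ENNReal.toReal_eq_one_iff] at this
    exact this
  · have := hint (R ⟨H, hH⟩)
    rw [hΛR, hev] at this
    simpa only [hR] using this

/-! ### The mean value inequality for linear subsolutions. -/

theorem continuous_sub_toENNReal (M : ℝ) :
    Continuous fun e : EReal => ((M : EReal) - e).toENNReal := by
  have h : Continuous fun e : EReal => (M : EReal) + -e := continuous_iff_continuousAt.2 fun e =>
    (EReal.continuousAt_add (p := ((M : EReal), -e)) (Or.inl (EReal.coe_ne_top _))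
      (Or.inl (EReal.coe_ne_bot _))).comp (f := fun e : EReal => ((M : EReal), -e))
      (continuousAt_const.prodMk continuous_neg.continuousAt)
  simp only [sub_eq_add_neg]
  exact EReal.continuous_toENNReal.comp h

theorem antitone_sub_toENNReal (M : ℝ) :
    Antitone fun e : EReal => ((M : EReal) - e).toENNReal := fun _ _ h =>
  EReal.toENNReal_le_toENNReal (EReal.sub_le_sub le_rfl h)

/-- Passing to the deficit below an upper bound `M` turns an upper semicontinuous function, possibly
`-∞`, into a lower semicontinuous `ENNReal`-valued one, whose integral is always defined. -/
theorem lowerSemicontinuousOn_sub_toENNReal {X : Type*} [TopologicalSpace X] {w : X → EReal}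
    {s : Set X} (hw : UpperSemicontinuousOn w s) (M : ℝ) :
    LowerSemicontinuousOn (fun y => ((M : EReal) - w y).toENNReal) s :=
  (continuous_sub_toENNReal M).comp_upperSemicontinuousOn_antitone hw (antitone_sub_toENNReal M)

theorem le_sub_of_ofReal_le {e : EReal} {M r : ℝ} (he : e ≤ M)
    (h : ENNReal.ofReal r ≤ ((M : EReal) - e).toENNReal) : e ≤ (M - r : ℝ) := by
  induction e using EReal.rec with
  | bot => exact bot_le
  | top => simp at he
  | coe x =>
    have he' : x ≤ M := by exact_mod_cast he
    rw [← EReal.coe_sub, EReal.toENNReal_of_ne_top (EReal.coe_ne_top _), EReal.toReal_coe,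
      ENNReal.ofReal_le_ofReal_iff (by linarith)] at h
    norm_cast
    linarith

theorem ofReal_le_of_le_sub {e : EReal} {M r : ℝ} (h : e ≤ (M - r : ℝ)) :
    ENNReal.ofReal r ≤ ((M : EReal) - e).toENNReal := by
  induction e using EReal.rec with
  | bot => simp
  | top =>
    rw [top_le_iff] at h
    exact absurd h (EReal.coe_ne_top _)
  | coe x =>
    have h' : x ≤ M - r := by exact_mod_cast h
    rw [← EReal.coe_sub, EReal.toENNReal_of_ne_top (EReal.coe_ne_top _), EReal.toReal_coe]
    exact ENNReal.ofReal_le_ofReal (by linarith)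

/-- A continuous `d` below the deficit is nearly a polynomial on the sphere, hence nearly a
polynomial solution `H` of the linear equation. Then `M - H` dominates `w` on the sphere, so also at
the centre, where `H 0` is the `μ`-mean of `H`. -/
theorem IsLinSub.lintegral_le {n : ℕ} [Nonempty (unitSphere n)]
    {ℓ : Matrix (Fin n) (Fin n) ℝ →ₗ[ℝ] ℝ} (hI : 0 < ℓ 1)
    {μ : Measure (unitSphere n)} [IsProbabilityMeasure μ]
    (hμ : ∀ H, polyOp ℓ H = 0 → ∫ σ : unitSphere n, polyFun H σ ∂μ = polyFun H 0)
    (hP : ∀ P : Matrix (Fin n) (Fin n) ℝ, P.PosSemidef → 0 ≤ ℓ P)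
    {w : Rn n → EReal} (hw : UpperSemicontinuousOn w (Metric.closedBall 0 1))
    (hsub : IsLinSub ℓ (Metric.ball 0 1) w) {M : ℝ}
    (hM : ∀ y ∈ Metric.closedBall (0 : Rn n) 1, w y ≤ M) :
    ∫⁻ σ : unitSphere n, ((M : EReal) - w σ).toENNReal ∂μ ≤ ((M : EReal) - w 0).toENNReal := by
  have hlsc : LowerSemicontinuous fun σ : unitSphere n => ((M : EReal) - w σ).toENNReal := by
    have h1 := (lowerSemicontinuousOn_sub_toENNReal hw M).mono Metric.sphere_subset_closedBall
    exact lowerSemicontinuous_restrict_iff.2 h1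
  refine lintegral_le_of_forall_continuous_le hlsc fun d hd0 hd => ?_
  have hint : ∀ f : C(unitSphere n, ℝ), Integrable (fun σ => f σ) μ := fun f =>
    f.continuous.integrable_of_hasCompactSupport (HasCompactSupport.of_compactSpace _)
  rw [← ofReal_integral_eq_lintegral_ofReal (hint d) (Filter.Eventually.of_forall hd0)]
  refine ENNReal.le_of_forall_pos_le_add fun ε hε _ => ?_
  have hε' : (0 : ℝ) < ε := hε
  obtain ⟨p, hp⟩ := exists_polyFun_near d (half_pos (half_pos hε'))
  obtain ⟨H₀, hH₀, hH₀p⟩ := exists_harmonic_eq_on_sphere hI hP p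
  -- The polynomial is within `c = ε / 4` of `d`; lowering it by `c` places `H` below `d`, with a
  -- loss of at most `2 c < ε`.
  set c : ℝ := (ε : ℝ) / 2 / 2
  set H := H₀ - MvPolynomial.C c
  have hC : polyOp ℓ (MvPolynomial.C c) = 0 := by simp [polyOp]
  have hH : polyOp ℓ H = 0 := by rw [map_sub, hH₀, hC, sub_self]
  have hHval : ∀ x, polyFun H x = polyFun H₀ x - c := fun x => by simp [H, polyFun]
  have hHd : ∀ σ : unitSphere n, |polyFun H σ + c - d σ| < c := fun σ => by
    rw [hHval, sub_add_cancel, hH₀p _ σ.2]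
    exact hp σ
  have h1 := hsub.le_of_le_on_sphere (h := fun y => M - polyFun H y) hI hw
    (fun y hy => (hM y hy).trans_lt (EReal.coe_lt_top _))
    (contDiff_const.sub (contDiff_polyFun H))
    (fun x => by
      have h2 := hessian_add (φ := fun _ => M) (ψ := fun y => - polyFun H y) (x := x)
        contDiffAt_const (contDiff_polyFun H).contDiffAt.neg
      rw [hessian_neg (contDiff_polyFun H).contDiffAt, hessian_const] at h2
      simp only [sub_eq_add_neg]
      rw [h2]
      simp [← polyFun_polyOp, hH, polyFun])
    (fun y hy => by
      refine le_sub_of_ofReal_le (hM y (Metric.sphere_subset_closedBall hy))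
        (le_trans (ENNReal.ofReal_le_ofReal ?_) (hd ⟨y, hy⟩))
      have := (abs_lt.1 (hHd ⟨y, hy⟩)).2
      linarith) 0 (by simp)
  refine le_trans ?_ (add_le_add_left (ofReal_le_of_le_sub h1) _)
  have h2 : ∫ σ, d σ ∂μ ≤ polyFun H 0 + ε := by
    rw [← hμ H hH]
    have h3 : Integrable (fun σ : unitSphere n => polyFun H σ) μ := by
      simpa only [polySphere_apply] using hint (polySphere n H)
    have h4 : ∫ σ : unitSphere n, polyFun H σ ∂μ + ε = ∫ σ : unitSphere n, (polyFun H σ + ε) ∂μ := by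
      rw [integral_add h3 (integrable_const _)]; simp
    rw [h4]
    refine integral_mono (hint d) (h3.add (integrable_const _)) fun σ => ?_
    have := (abs_lt.1 (hHd σ)).1
    simp only [c] at this ⊢
    linarith
  refine (ENNReal.ofReal_le_ofReal h2).trans ?_
  refine (ENNReal.ofReal_add_le).trans ?_
  simp

/-! ### The orthogonal group and averaging over a transitive subgroup. -/

/-- The action of the orthogonal group on `ℝⁿ`. -/
def act {n : ℕ} (g : Matrix.orthogonalGroup (Fin n) ℝ) (x : Rn n) : Rn n :=
  Matrix.toEuclideanLin (g : Matrix (Fin n) (Fin n) ℝ) x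

theorem act_mul {n : ℕ} (g h : Matrix.orthogonalGroup (Fin n) ℝ) (x : Rn n) :
    act (g * h) x = act g (act h x) := by
  simp [act, Matrix.toLpLin_apply, Matrix.mulVec_mulVec]

theorem act_one {n : ℕ} (x : Rn n) : act 1 x = x := by
  simp [act]

theorem act_inv_act {n : ℕ} (g : Matrix.orthogonalGroup (Fin n) ℝ) (x : Rn n) :
    act g⁻¹ (act g x) = x := by
  rw [← act_mul, inv_mul_cancel, act_one]

theorem act_act_inv {n : ℕ} (g : Matrix.orthogonalGroup (Fin n) ℝ) (x : Rn n) :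
    act g (act g⁻¹ x) = x := by
  rw [← act_mul, mul_inv_cancel, act_one]

theorem act_add {n : ℕ} (g : Matrix.orthogonalGroup (Fin n) ℝ) (x y : Rn n) :
    act g (x + y) = act g x + act g y := map_add _ _ _

theorem act_smul {n : ℕ} (g : Matrix.orthogonalGroup (Fin n) ℝ) (c : ℝ) (x : Rn n) :
    act g (c • x) = c • act g x := map_smul _ _ _

theorem norm_act {n : ℕ} (g : Matrix.orthogonalGroup (Fin n) ℝ) (x : Rn n) :
    ‖act g x‖ = ‖x‖ := by
  have h : ‖act g x‖ ^ 2 = ‖x‖ ^ 2 := by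
    rw [← real_inner_self_eq_norm_sq, ← real_inner_self_eq_norm_sq]
    simp only [act, Matrix.toLpLin_apply, EuclideanSpace.inner_eq_star_dotProduct, star_trivial]
    rw [Matrix.dotProduct_mulVec, ← Matrix.mulVec_transpose, Matrix.mulVec_mulVec]
    have := Matrix.UnitaryGroup.star_mul_self g
    rw [Matrix.star_eq_conjTranspose, Matrix.conjTranspose_eq_transpose_of_trivial] at this
    rw [this, Matrix.one_mulVec]
  exact (sq_eq_sq₀ (norm_nonneg _) (norm_nonneg _)).1 h

theorem continuous_act_uncurry {n : ℕ} :
    Continuous fun p : Matrix.orthogonalGroup (Fin n) ℝ × Rn n => act p.1 p.2 := by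
  simp only [act, Matrix.toLpLin_apply]
  refine (PiLp.continuous_toLp 2 _).comp ?_
  exact (continuous_subtype_val.comp continuous_fst).matrix_mulVec
    ((PiLp.continuous_ofLp 2 _).comp continuous_snd)

theorem continuous_act {n : ℕ} (g : Matrix.orthogonalGroup (Fin n) ℝ) :
    Continuous (act g : Rn n → Rn n) :=
  continuous_act_uncurry.comp (Continuous.prodMk_right g)

/-- An orthogonal matrix as a linear isometry of `ℝⁿ`. -/
def actIsometry {n : ℕ} (g : Matrix.orthogonalGroup (Fin n) ℝ) : Rn n ≃ₗᵢ[ℝ] Rn n where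
  toFun := act g
  map_add' := act_add g
  map_smul' := act_smul g
  invFun := act g⁻¹
  left_inv := act_inv_act g
  right_inv := act_act_inv g
  norm_map' := norm_act g

instance {n : ℕ} : MeasurableSpace (Matrix.orthogonalGroup (Fin n) ℝ) := borel _

instance {n : ℕ} : BorelSpace (Matrix.orthogonalGroup (Fin n) ℝ) := ⟨rfl⟩

instance {n : ℕ} : SecondCountableTopology (Matrix.orthogonalGroup (Fin n) ℝ) :=
  have : SecondCountableTopology (Matrix (Fin n) (Fin n) ℝ) :=
    inferInstanceAs (SecondCountableTopology (Fin n → Fin n → ℝ))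
  TopologicalSpace.Subtype.secondCountableTopology _

instance {n : ℕ} : CompactSpace (Matrix.orthogonalGroup (Fin n) ℝ) := by
  refine isCompact_iff_compactSpace.1 ?_
  have hK : IsCompact (Set.pi Set.univ fun _ : Fin n => Set.pi Set.univ fun _ : Fin n =>
      Set.Icc (-1 : ℝ) 1) :=
    isCompact_univ_pi fun _ => isCompact_univ_pi fun _ => isCompact_Icc
  refine hK.of_isClosed_subset ?_ ?_
  · have : (Matrix.orthogonalGroup (Fin n) ℝ : Set (Matrix (Fin n) (Fin n) ℝ)) =
        {A | A * star A = 1} := by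
      ext A; exact Matrix.mem_unitaryGroup_iff
    rw [this]
    exact isClosed_eq (Continuous.mul (f := fun A : Matrix (Fin n) (Fin n) ℝ => A)
      continuous_id continuous_star) continuous_const
  · intro A hA i _ j _
    exact abs_le.1 (entry_norm_bound_of_unitary hA i j)

open scoped Pointwise in
-- The surface measure of a set is a constant times the volume of the cone over it. An orthogonal
-- map commutes with forming cones and preserves volume.
theorem lintegral_toSphere_act {n : ℕ} (g : Matrix.orthogonalGroup (Fin n) ℝ)
    {D : Rn n → ENNReal} (hD : Measurable D) :
    ∫⁻ σ : unitSphere n, D (act g σ) ∂(volume : Measure (Rn n)).toSphere =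
      ∫⁻ σ : unitSphere n, D σ ∂(volume : Measure (Rn n)).toSphere := by
  let T : unitSphere n → unitSphere n := fun σ => ⟨act g σ, by
    rw [mem_sphere_zero_iff_norm, norm_act]; exact mem_sphere_zero_iff_norm.1 σ.2⟩
  have hT : Measurable T :=
    (((continuous_act g).comp continuous_subtype_val).subtype_mk _).measurable
  have hmap : Measure.map T (volume : Measure (Rn n)).toSphere =
      (volume : Measure (Rn n)).toSphere := by
    ext s hs
    rw [Measure.map_apply hT hs, Measure.toSphere_apply' _ (hT hs), Measure.toSphere_apply' _ hs]
    congr 1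
    have := (actIsometry g).measurePreserving.measure_preimage_emb
      (actIsometry g).toHomeomorph.measurableEmbedding
      (Set.Ioo (0 : ℝ) 1 • (Subtype.val '' s : Set (Rn n)))
    rw [← this]
    congr 1
    ext x
    simp only [Set.mem_smul, Set.mem_image, Set.mem_preimage]
    constructor
    · rintro ⟨r, hr, _, ⟨σ, hσ, rfl⟩, rfl⟩
      exact ⟨r, hr, _, ⟨T σ, hσ, rfl⟩, (act_smul g r σ).symm⟩
    · rintro ⟨r, hr, _, ⟨σ, hσ, rfl⟩, h⟩
      have hτ : act g⁻¹ σ ∈ Metric.sphere (0 : Rn n) 1 := by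
        rw [mem_sphere_zero_iff_norm, norm_act]; exact mem_sphere_zero_iff_norm.1 σ.2
      refine ⟨r, hr, act g⁻¹ σ, ⟨⟨act g⁻¹ σ, hτ⟩, ?_, rfl⟩, ?_⟩
      · have : T ⟨act g⁻¹ σ, hτ⟩ = σ := Subtype.ext (act_act_inv g σ)
        rwa [this]
      · rw [← act_smul, h]
        exact act_inv_act g x
  conv_rhs => rw [← hmap]
  exact (lintegral_map (f := fun σ : unitSphere n => D σ)
    (hD.comp measurable_subtype_coe) hT).symm

theorem lintegral_sphereMeasure_act {n : ℕ} (g : Matrix.orthogonalGroup (Fin n) ℝ)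
    {D : Rn n → ENNReal} (hD : Measurable D) :
    ∫⁻ σ : unitSphere n, D (act g σ) ∂sphereMeasure n =
      ∫⁻ σ : unitSphere n, D σ ∂sphereMeasure n := by
  simp only [sphereMeasure, lintegral_smul_measure, lintegral_toSphere_act g hD]

theorem isProbabilityMeasure_sphereMeasure {n : ℕ} [Nonempty (unitSphere n)] :
    IsProbabilityMeasure (sphereMeasure n) := by
  refine ⟨?_⟩
  obtain ⟨σ⟩ := ‹Nonempty (unitSphere n)›
  have hnt : Nontrivial (Rn n) := ⟨σ, 0, fun h => by
    have := mem_sphere_zero_iff_norm.1 σ.2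
    rw [h] at this; simp at this⟩
  simp only [sphereMeasure, Measure.smul_apply, smul_eq_mul]
  refine ENNReal.inv_mul_cancel ?_ (measure_ne_top _ _)
  rw [Ne, Measure.measure_univ_eq_zero]
  exact Measure.toSphere_ne_zero _

/-- Averaging over a group which is transitive on the sphere is spherical averaging. -/
theorem exists_averaging_measure {n : ℕ} [Nonempty (unitSphere n)]
    (G : Subgroup (Matrix.orthogonalGroup (Fin n) ℝ))
    (htrans : ∀ x y : Rn n, ‖x‖ = 1 → ‖y‖ = 1 → ∃ g ∈ G, act g x = y) :
    ∃ ν : Measure (Matrix.orthogonalGroup (Fin n) ℝ), IsProbabilityMeasure ν ∧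
      (∀ᵐ g ∂ν, g ∈ G.topologicalClosure) ∧
      ∀ D : Rn n → ENNReal, Measurable D → ∀ y,
        ∫⁻ g, D (act g y) ∂ν = ∫⁻ σ : unitSphere n, D (‖y‖ • (σ : Rn n)) ∂sphereMeasure n := by
  set Γ := G.topologicalClosure
  have := isProbabilityMeasure_sphereMeasure (n := n)
  have : CompactSpace Γ := isCompact_iff_compactSpace.1 G.isClosed_topologicalClosure.isCompact
  let K : TopologicalSpace.PositiveCompacts Γ := ⟨⟨Set.univ, isCompact_univ⟩, by simp⟩
  set η : Measure Γ := Measure.haarMeasure K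
  have : IsProbabilityMeasure η := ⟨Measure.haarMeasure_self⟩
  have hj : Measurable fun g : Γ => ((g⁻¹ : Γ) : Matrix.orthogonalGroup (Fin n) ℝ) :=
    (continuous_subtype_val.comp continuous_inv).measurable
  -- Haar measure is pushed forward by inversion so that its left invariance applies: replacing `g`
  -- by `g₀ g` turns `g⁻¹ g₀ y` into `g⁻¹ y`.
  refine ⟨Measure.map (fun g : Γ => ((g⁻¹ : Γ) : Matrix.orthogonalGroup (Fin n) ℝ)) η,
    Measure.isProbabilityMeasure_map hj.aemeasurable, ?_, fun D hD y => ?_⟩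
  · refine (ae_map_iff (p := fun g => g ∈ Γ) hj.aemeasurable
      G.isClosed_topologicalClosure.measurableSet).2 ?_
    exact Filter.Eventually.of_forall fun g => (g⁻¹).2
  have hact : ∀ z : Rn n, Measurable fun g => D (act g z) := fun z =>
    hD.comp (continuous_act_uncurry.comp (Continuous.prodMk_left z)).measurable
  rw [lintegral_map (hact y) hj]
  have hsph : ∀ x : Rn n, ‖x‖ = ‖y‖ →
      ∫⁻ g : Γ, D (act ((g⁻¹ : Γ) : Matrix.orthogonalGroup (Fin n) ℝ) x) ∂η =
      ∫⁻ g : Γ, D (act ((g⁻¹ : Γ) : Matrix.orthogonalGroup (Fin n) ℝ) y) ∂η := by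
    intro x hx
    obtain ⟨g₀, hg₀, rfl⟩ : ∃ g₀ ∈ G, act g₀ y = x := by
      by_cases hy : ‖y‖ = 0
      · have hy0 : y = 0 := norm_eq_zero.1 hy
        have hx0 : x = 0 := norm_eq_zero.1 (hx.trans hy)
        exact ⟨1, G.one_mem, by rw [act_one, hy0, hx0]⟩
      · obtain ⟨g₀, hg₀, h⟩ := htrans (‖y‖⁻¹ • y) (‖y‖⁻¹ • x)
          (by rw [norm_smul, norm_inv, norm_norm, inv_mul_cancel₀ hy])
          (by rw [norm_smul, norm_inv, norm_norm, hx, inv_mul_cancel₀ hy])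
        refine ⟨g₀, hg₀, ?_⟩
        rw [act_smul] at h
        exact smul_right_injective _ (inv_ne_zero hy) h
    have hg₀' : g₀ ∈ Γ := G.le_topologicalClosure hg₀
    rw [← lintegral_mul_left_eq_self (μ := η)
      (fun g : Γ => D (act ((g⁻¹ : Γ) : Matrix.orthogonalGroup (Fin n) ℝ) (act g₀ y))) ⟨g₀, hg₀'⟩]
    refine lintegral_congr fun g => ?_
    rw [← act_mul]
    congr 2
    simp
  have hc : Continuous fun p : unitSphere n × Γ =>
      act ((p.2⁻¹ : Γ) : Matrix.orthogonalGroup (Fin n) ℝ) (‖y‖ • (p.1 : Rn n)) :=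
    continuous_act_uncurry.comp (f := fun p : unitSphere n × Γ =>
      (((p.2⁻¹ : Γ) : Matrix.orthogonalGroup (Fin n) ℝ), ‖y‖ • (p.1 : Rn n)))
      ((continuous_subtype_val.comp (continuous_inv.comp continuous_snd)).prodMk
        (Continuous.const_smul (g := fun p : unitSphere n × Γ => (p.1 : Rn n))
          (continuous_subtype_val.comp continuous_fst) ‖y‖))
  have hmeas : Measurable fun p : unitSphere n × Γ =>
      D (act ((p.2⁻¹ : Γ) : Matrix.orthogonalGroup (Fin n) ℝ) (‖y‖ • (p.1 : Rn n))) :=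
    hD.comp hc.measurable
  -- The group average depends on `‖y‖` only, so it may be averaged over the sphere at no cost.
  -- After Tonelli, rotation invariance of the surface measure removes `g`.
  calc ∫⁻ g : Γ, D (act ((g⁻¹ : Γ) : Matrix.orthogonalGroup (Fin n) ℝ) y) ∂η
      = ∫⁻ σ : unitSphere n, ∫⁻ g : Γ, D (act ((g⁻¹ : Γ) : Matrix.orthogonalGroup (Fin n) ℝ)
          (‖y‖ • (σ : Rn n))) ∂η ∂sphereMeasure n := by
        rw [lintegral_congr fun σ : unitSphere n => hsph (‖y‖ • (σ : Rn n)) (by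
          rw [norm_smul, norm_norm, mem_sphere_zero_iff_norm.1 σ.2, mul_one])]
        rw [lintegral_const, measure_univ, mul_one]
    _ = ∫⁻ g : Γ, ∫⁻ σ : unitSphere n, D (act ((g⁻¹ : Γ) : Matrix.orthogonalGroup (Fin n) ℝ)
          (‖y‖ • (σ : Rn n))) ∂sphereMeasure n ∂η := by
        exact lintegral_lintegral_swap hmeas.aemeasurable
    _ = ∫⁻ g : Γ, ∫⁻ σ : unitSphere n, D (‖y‖ • (σ : Rn n)) ∂sphereMeasure n ∂η := by
        refine lintegral_congr fun g => ?_
        have := lintegral_sphereMeasure_act (g⁻¹ : Γ).1 (D := fun x => D (‖y‖ • x))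
          (hD.comp (continuous_const_smul _).measurable)
        simpa only [act_smul] using this
    _ = _ := by rw [lintegral_const, measure_univ, mul_one]

/-! ### Invariance, supporting functionals and the Riesz characteristic. -/

/-- Closedness of `F` allows passage from `G` to its compact closure, on which Haar measure can be
normalised. -/
theorem conj_mem_of_mem_closure {n : ℕ} {F : Set (SymMat n)} (hF : IsClosed F)
    {G : Subgroup (Matrix.orthogonalGroup (Fin n) ℝ)} (hG : ∀ g ∈ G, ∀ A ∈ F, conj g A ∈ F) :
    ∀ g ∈ G.topologicalClosure, ∀ A ∈ F, conj g A ∈ F := by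
  intro g hg A hA
  have hc : Continuous fun g : Matrix.orthogonalGroup (Fin n) ℝ => conj g A := by
    refine Continuous.subtype_mk ?_ _
    exact (continuous_subtype_val.mul continuous_const).mul
      (continuous_star.comp continuous_subtype_val)
  have hsub : closure (G : Set (Matrix.orthogonalGroup (Fin n) ℝ)) ⊆ {g | conj g A ∈ F} :=
    closure_minimal (fun g hg => hG g hg A hA) (hF.preimage hc)
  exact hsub hg

/-- Hessians of test functions transform by `r² gᵀ (·) g`: the cone property absorbs `r²` and the
invariance absorbs the conjugation. -/
theorem IsSubharmonic.comp_similarity {n : ℕ} {F : Set (SymMat n)} (hcone : IsCone F)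
    {g : Matrix.orthogonalGroup (Fin n) ℝ} (hg : ∀ A ∈ F, conj g⁻¹ A ∈ F)
    {X : Set (Rn n)} {v : Rn n → EReal} (hv : IsSubharmonic F X v) (b : Rn n) {r : ℝ}
    (hr : 0 < r) :
    IsSubharmonic F {y | b + r • act g y ∈ X} fun y => v (b + r • act g y) := by
  have hT : Continuous fun y => b + r • act g y :=
    continuous_const.add ((continuous_act g).const_smul r)
  let S : Rn n → Rn n := fun z => r⁻¹ • act g⁻¹ (z - b)
  have hTS : ∀ z, b + r • act g (S z) = z := fun z => by
    simp only [S]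
    rw [act_smul, act_act_inv, smul_inv_smul₀ hr.ne', add_sub_cancel]
  have hST : ∀ y, S (b + r • act g y) = y := fun y => by
    simp only [S]
    rw [add_sub_cancel_left, act_smul, act_inv_act, inv_smul_smul₀ hr.ne']
  have hS : ContDiff ℝ 2 S := by
    have : ContDiff ℝ 2 fun z : Rn n => act g⁻¹ z := (actIsometry g⁻¹).contDiff
    exact (this.comp (contDiff_id.sub contDiff_const)).const_smul _
  refine ⟨?_, fun y hy => hv.lt_top _ hy, fun y hy φ hφ hle heq => ?_⟩
  · exact hv.usc.comp hT.continuousOn fun y hy => hy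
  set z := b + r • act g y
  have hψ : ContDiffAt ℝ 2 (fun z => φ (S z)) z := by
    refine ContDiffAt.comp z ?_ hS.contDiffAt
    rwa [hST]
  obtain ⟨A, hA, hAψ⟩ := hv.viscosity z hy (fun z => φ (S z)) hψ
    (by
      have h1 : ∀ᶠ y' in 𝓝 (S z), v (b + r • act g y') ≤ φ y' := by rwa [hST]
      filter_upwards [hS.continuous.continuousAt.eventually h1] with z' hz'
      rwa [hTS] at hz')
    (by simp only [z, hST]; exact heq)
  have hlin : ∀ y, Matrix.toEuclideanLin (r • (g : Matrix (Fin n) (Fin n) ℝ)) y = r • act g y :=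
    fun y => by rw [map_smul]; rfl
  have hcomp := hessian_comp_affine (φ := fun z => φ (S z)) (b := b) (x := y)
    (r • (g : Matrix (Fin n) (Fin n) ℝ)) (by rw [hlin]; exact hψ)
  simp only [hlin, hST] at hcomp
  refine ⟨(r ^ 2) • conj g⁻¹ A, hcone _ (by positivity) _ (hg A hA), ?_⟩
  rw [hcomp, ← hAψ]
  simp only [conj, Matrix.UnitaryGroup.inv_val, star_star]
  rw [selfAdjoint.val_smul]
  simp only [Matrix.transpose_smul, Matrix.smul_mul, Matrix.mul_smul, smul_smul, ← sq,
    Matrix.star_eq_conjTranspose, Matrix.conjTranspose_eq_transpose_of_trivial]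

theorem IsSubharmonic.isLinSub {n : ℕ} {F : Set (SymMat n)}
    {ℓ : Matrix (Fin n) (Fin n) ℝ →ₗ[ℝ] ℝ} (hℓ : ∀ A ∈ F, 0 ≤ ℓ (A : Matrix (Fin n) (Fin n) ℝ))
    {X : Set (Rn n)} {v : Rn n → EReal} (hv : IsSubharmonic F X v) : IsLinSub ℓ X v := by
  intro x hx φ hφ hle heq
  obtain ⟨A, hA, h⟩ := hv.viscosity x hx φ hφ hle heq
  exact h ▸ hℓ A hA

/-- The absolute entry sum bounds the quadratic form, since `|x i * x j| ≤ |x|²`. -/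
theorem posSemidef_smul_one_add {n : ℕ} (A : SymMat n) {t : ℝ}
    (ht : ∑ i, ∑ j, |(A : Matrix (Fin n) (Fin n) ℝ) i j| ≤ t) :
    (t • (1 : Matrix (Fin n) (Fin n) ℝ) + A).PosSemidef := by
  refine Matrix.PosSemidef.of_dotProduct_mulVec_nonneg ?_ fun x => ?_
  · have h1 : IsSelfAdjoint (t • (1 : Matrix (Fin n) (Fin n) ℝ)) :=
      (IsSelfAdjoint.all t).smul (IsSelfAdjoint.one _)
    have h2 : IsSelfAdjoint (A : Matrix (Fin n) (Fin n) ℝ) := A.2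
    exact h1.add h2
  have hsq : ∀ i, x i ^ 2 ≤ ∑ k, x k ^ 2 := fun i =>
    Finset.single_le_sum (f := fun k => x k ^ 2) (fun k _ => sq_nonneg _) (Finset.mem_univ i)
  set q := ∑ k, x k ^ 2
  have hq : 0 ≤ q := Finset.sum_nonneg fun k _ => sq_nonneg _
  have h1 : -(∑ i, ∑ j, |(A : Matrix (Fin n) (Fin n) ℝ) i j|) * q ≤
      ∑ i, ∑ j, x i * ((A : Matrix (Fin n) (Fin n) ℝ) i j * x j) := by
    rw [neg_mul, Finset.sum_mul, ← Finset.sum_neg_distrib]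
    refine Finset.sum_le_sum fun i _ => ?_
    rw [Finset.sum_mul, ← Finset.sum_neg_distrib]
    refine Finset.sum_le_sum fun j _ => ?_
    have h2 : |x i * x j| ≤ q := by
      rw [abs_le]
      constructor <;> nlinarith [hsq i, hsq j, sq_nonneg (x i - x j), sq_nonneg (x i + x j)]
    have h3 : |x i * ((A : Matrix (Fin n) (Fin n) ℝ) i j * x j)| ≤
        |(A : Matrix (Fin n) (Fin n) ℝ) i j| * q := by
      rw [show x i * ((A : Matrix (Fin n) (Fin n) ℝ) i j * x j) =
        (A : Matrix (Fin n) (Fin n) ℝ) i j * (x i * x j) by ring, abs_mul]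
      gcongr
    linarith [(abs_le.1 h3).1]
  simp only [star_trivial, Matrix.add_mulVec, Matrix.smul_mulVec, Matrix.one_mulVec,
    dotProduct_add, dotProduct_smul, smul_eq_mul]
  have h4 : x ⬝ᵥ x = q := by simp [dotProduct, q, sq]
  have h5 : x ⬝ᵥ (A : Matrix (Fin n) (Fin n) ℝ).mulVec x =
      ∑ i, ∑ j, x i * ((A : Matrix (Fin n) (Fin n) ℝ) i j * x j) := by
    simp [dotProduct, Matrix.mulVec, Finset.mul_sum]
  rw [h4, h5]
  nlinarith

/-- Every `B` close to `A + ε I` still satisfies `B - A ≥ 0`, so positivity places a whole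
neighbourhood in `F`. -/
theorem IsSubequation.add_smul_one_mem_interior {n : ℕ} {F : Set (SymMat n)}
    (hF : IsSubequation F) {A : SymMat n} (hA : A ∈ F) {ε : ℝ} (hε : 0 < ε) :
    A + ε • (1 : SymMat n) ∈ interior F := by
  set N : SymMat n → ℝ := fun B =>
    ∑ i, ∑ j, |((B - (A + ε • (1 : SymMat n)) : SymMat n) : Matrix (Fin n) (Fin n) ℝ) i j|
  have hN : Continuous N := by
    refine continuous_finsetSum _ fun i _ => continuous_finsetSum _ fun j _ => ?_
    refine continuous_abs.comp ?_
    have h1 : Continuous fun B : SymMat n =>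
        ((B - (A + ε • (1 : SymMat n)) : SymMat n) : Matrix (Fin n) (Fin n) ℝ) :=
      continuous_subtype_val.comp (continuous_id.sub continuous_const)
    exact h1.matrix_elem i j
  refine mem_interior.2 ⟨{B | N B < ε}, fun B hB => ?_, isOpen_lt hN continuous_const, ?_⟩
  · have hP := posSemidef_smul_one_add (B - (A + ε • (1 : SymMat n))) (le_of_lt hB)
    have := hF.positivity A hA (ε • (1 : SymMat n) + (B - (A + ε • (1 : SymMat n)))) (by
      simpa using hP)
    convert this using 1
    abel
  · simp [N, hε]

theorem IsCone.zero_mem {n : ℕ} {F : Set (SymMat n)} (hcone : IsCone F) (hne : F.Nonempty) :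
    (0 : SymMat n) ∈ F := by
  obtain ⟨A, hA⟩ := hne
  simpa using hcone 0 le_rfl A hA

theorem mem_of_posSemidef {n : ℕ} {F : Set (SymMat n)} (hF : IsSubequation F) (hcone : IsCone F)
    (hne : F.Nonempty) {P : SymMat n} (hP : (P : Matrix (Fin n) (Fin n) ℝ).PosSemidef) :
    P ∈ F := by
  simpa using hF.positivity 0 (hcone.zero_mem hne) P hP

/-- A point outside the interior of a convex cone subequation is separated from it by a
nonnegative functional. -/
theorem exists_supporting {n : ℕ} {F : Set (SymMat n)} (hF : IsSubequation F) (hcone : IsCone F)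
    (hconv : Convex ℝ F) (hne : F.Nonempty) {E : SymMat n} (hE : E ∉ interior F) :
    ∃ ℓ : Matrix (Fin n) (Fin n) ℝ →ₗ[ℝ] ℝ,
      (∀ P : Matrix (Fin n) (Fin n) ℝ, P.PosSemidef → 0 ≤ ℓ P) ∧ 0 < ℓ 1 ∧
      (∀ A ∈ F, 0 ≤ ℓ (A : Matrix (Fin n) (Fin n) ℝ)) ∧ ℓ (E : Matrix (Fin n) (Fin n) ℝ) ≤ 0 := by
  have : ContinuousSMul ℝ (SymMat n) :=
    ⟨Continuous.subtype_mk (continuous_fst.smul (continuous_subtype_val.comp continuous_snd)) _⟩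
  obtain ⟨f, hf⟩ := geometric_hahn_banach_open_point hconv.interior isOpen_interior hE
  have h1 : ∀ A ∈ F, f A ≤ f E := fun A hA => by
    have h2 : Filter.Tendsto (fun ε : ℝ => f A + ε * f 1) (𝓝[>] 0) (𝓝 (f A + 0 * f 1)) := by
      refine Filter.Tendsto.mono_left (Continuous.tendsto ?_ _) nhdsWithin_le_nhds
      fun_prop
    rw [zero_mul, add_zero] at h2
    refine le_of_tendsto h2 ?_
    filter_upwards [self_mem_nhdsWithin] with ε hε
    have := hf _ (hF.add_smul_one_mem_interior hA hε)
    rw [map_add, map_smul, smul_eq_mul] at this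
    exact this.le
  have hE0 : 0 ≤ f E := by simpa using h1 0 (hcone.zero_mem hne)
  have h2 : ∀ A ∈ F, f A ≤ 0 := fun A hA => by
    by_contra! hpos
    have h3 := h1 _ (hcone ((f E + 1) / f A) (by positivity) A hA)
    rw [map_smul, smul_eq_mul, div_mul_cancel₀ _ hpos.ne'] at h3
    linarith
  have h1mem : (1 : SymMat n) ∈ F := mem_of_posSemidef hF hcone hne (by
    simpa using Matrix.PosSemidef.one)
  have h3 : f 1 < 0 := by
    refine lt_of_le_of_ne (h2 1 h1mem) fun h0 => ?_
    -- If `f 1 = 0`, adding a large multiple of `1` moves any `A` into `F` without changing `f A`.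
    -- So `f ≤ 0` everywhere, which contradicts the strict separation `f 1 < f E`.
    have h4 : ∀ A : SymMat n, f A ≤ 0 := fun A => by
      have h5 := h2 _ (mem_of_posSemidef hF hcone hne
        (P := (∑ i, ∑ j, |(A : Matrix (Fin n) (Fin n) ℝ) i j|) • (1 : SymMat n) + A)
        (by simpa using posSemidef_smul_one_add A le_rfl))
      rw [map_add, map_smul, h0, smul_zero, zero_add] at h5
      exact h5
    have h5 := hf _ (hF.add_smul_one_mem_interior (hcone.zero_mem hne) one_pos)
    have h6 := h4 E
    simp [h0] at h5
    linarith
  -- Symmetrising first extends the functional to all matrices; the sign makes it nonnegative on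
  -- `F`.
  refine ⟨-(f.toLinearMap ∘ₗ selfAdjointPart ℝ), ?_, ?_, ?_, ?_⟩
  · intro P hP
    have := h2 _ (mem_of_posSemidef hF hcone hne (P := ⟨P, hP.isHermitian⟩) hP)
    have h7 : selfAdjointPart ℝ P = ⟨P, hP.isHermitian⟩ :=
      Subtype.ext (IsSelfAdjoint.coe_selfAdjointPart_apply ℝ hP.isHermitian)
    simpa [h7] using this
  · have h7 : selfAdjointPart ℝ (1 : Matrix (Fin n) (Fin n) ℝ) = 1 :=
      Subtype.ext (IsSelfAdjoint.coe_selfAdjointPart_apply ℝ (IsSelfAdjoint.one _))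
    simpa [h7] using h3
  · intro A hA
    have h7 : selfAdjointPart ℝ (A : Matrix (Fin n) (Fin n) ℝ) = A :=
      Subtype.ext (IsSelfAdjoint.coe_selfAdjointPart_apply ℝ A.2)
    simpa [h7] using h2 A hA
  · have h7 : selfAdjointPart ℝ (E : Matrix (Fin n) (Fin n) ℝ) = E :=
      Subtype.ext (IsSelfAdjoint.coe_selfAdjointPart_apply ℝ E.2)
    simpa [h7] using hE0

/-- The matrix `I - p e eᵀ`. -/
def rieszMat {n : ℕ} (p : ℝ) (e : Rn n) : SymMat n :=
  ⟨1 - p • Matrix.vecMulVec e e, by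
    refine (IsSelfAdjoint.one _).sub ?_
    ext i j
    simp [Matrix.vecMulVec_apply, mul_comm]⟩

theorem conj_rieszMat {n : ℕ} (g : Matrix.orthogonalGroup (Fin n) ℝ) (p : ℝ) (e : Rn n) :
    conj g (rieszMat p e) = rieszMat p (act g e) := by
  apply Subtype.ext
  have h1 := Matrix.mem_unitaryGroup_iff.1 g.2
  have h2 : (act g e).ofLp = (g : Matrix (Fin n) (Fin n) ℝ).mulVec e.ofLp := by
    simp [act, Matrix.toLpLin_apply]
  simp only [conj, rieszMat, mul_sub, sub_mul, mul_one, h1, Matrix.mul_smul, Matrix.smul_mul,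
    Matrix.mul_vecMulVec, Matrix.vecMulVec_mul, h2]
  rw [Matrix.star_eq_conjTranspose, Matrix.conjTranspose_eq_transpose_of_trivial,
    Matrix.vecMul_transpose]

theorem eq_univ_of_neg_one_mem {n : ℕ} {F : Set (SymMat n)} (hF : IsSubequation F)
    (hcone : IsCone F) (h : (-1 : SymMat n) ∈ F) : F = Set.univ := by
  refine Set.eq_univ_of_forall fun A => ?_
  set t := ∑ i, ∑ j, |(A : Matrix (Fin n) (Fin n) ℝ) i j|
  have ht : 0 ≤ t := Finset.sum_nonneg fun i _ => Finset.sum_nonneg fun j _ => abs_nonneg _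
  have := hF.positivity _ (hcone t ht _ h) (t • (1 : SymMat n) + A)
    (by simpa using posSemidef_smul_one_add A le_rfl)
  simpa using this

theorem sum_mem_of_cone {n : ℕ} {F : Set (SymMat n)} (hcone : IsCone F) (hconv : Convex ℝ F)
    (hne : F.Nonempty) {ι : Type*} (s : Finset ι) (A : ι → SymMat n) (hA : ∀ i ∈ s, A i ∈ F) :
    ∑ i ∈ s, A i ∈ F := by
  classical
  induction s using Finset.induction_on with
  | empty => simpa using hcone.zero_mem hne
  | insert i s hi ih =>
    rw [Finset.sum_insert hi]
    have h1 := hconv (hA i (Finset.mem_insert_self i s))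
      (ih fun j hj => hA j (Finset.mem_insert_of_mem hj)) (a := 1 / 2) (b := 1 / 2)
      (by norm_num) (by norm_num) (by norm_num)
    have h2 := hcone 2 (by norm_num) _ h1
    rw [smul_add, smul_smul, smul_smul] at h2
    norm_num at h2
    exact h2

/-- The Riesz characteristic of an ST-invariant convex cone subequation. -/
theorem exists_rieszCharacteristic {n : ℕ} {F : Set (SymMat n)} (hF : IsSubequation F)
    (hcone : IsCone F) (hconv : Convex ℝ F) (hne : F.Nonempty) (huniv : F ≠ Set.univ)
    {G : Subgroup (Matrix.orthogonalGroup (Fin n) ℝ)} (hG : ∀ g ∈ G, ∀ A ∈ F, conj g A ∈ F)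
    (htrans : ∀ x y : Rn n, ‖x‖ = 1 → ‖y‖ = 1 → ∃ g ∈ G, act g x = y) :
    ∃ p : ℝ, ∀ e : Rn n, ‖e‖ = 1 → rieszMat p e ∈ F ∧ rieszMat p e ∉ interior F := by
  have hcont : ∀ e : Rn n, Continuous fun p : ℝ => rieszMat p e := fun e =>
    Continuous.subtype_mk (continuous_const.sub (continuous_id.smul continuous_const)) _
  set Q : Set ℝ := {p | ∀ e : Rn n, ‖e‖ = 1 → rieszMat p e ∈ F}
  have hQc : IsClosed Q := by
    have : Q = ⋂ (e : Rn n) (_ : ‖e‖ = 1), {p | rieszMat p e ∈ F} := by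
      ext p; simp [Q]
    rw [this]
    exact isClosed_iInter fun e => isClosed_iInter fun _ => hF.isClosed.preimage (hcont e)
  have hQ0 : (0 : ℝ) ∈ Q := fun e _ => mem_of_posSemidef hF hcone hne (by
    simpa [rieszMat] using Matrix.PosSemidef.one)
  have hQb : BddAbove Q := by
    refine ⟨n, fun p hp => ?_⟩
    by_contra! hlt
    -- Summing over an orthonormal basis gives `(n - p) I`. For `p > n` this puts `-I` in `F`, and
    -- then `F` is everything.
    have h1 := sum_mem_of_cone hcone hconv hne Finset.univ
      (fun i : Fin n => rieszMat p (EuclideanSpace.single i 1)) fun i _ => hp _ (by simp)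
    have h2 : ∑ i : Fin n, rieszMat p (EuclideanSpace.single i (1 : ℝ)) =
        (p - n) • (-1 : SymMat n) := by
      apply Subtype.ext
      rw [AddSubgroup.val_finsetSum, selfAdjoint.val_smul]
      ext a b
      simp only [rieszMat, Matrix.sum_apply, Matrix.sub_apply, Matrix.smul_apply,
        Matrix.vecMulVec_apply, Finset.sum_sub_distrib]
      by_cases hab : a = b
      · subst hab
        simp
      · simp [hab]
    rw [h2] at h1
    have h3 := hcone (p - n)⁻¹ (inv_nonneg.2 (by linarith)) _ h1
    rw [inv_smul_smul₀ (by linarith : p - n ≠ 0)] at h3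
    exact huniv (eq_univ_of_neg_one_mem hF hcone h3)
  refine ⟨sSup Q, fun e he => ⟨hQc.csSup_mem ⟨0, hQ0⟩ hQb e he, fun hint => ?_⟩⟩
  -- If one direction gave an interior point, a slightly larger `p` would work for that direction,
  -- and by transitivity for every direction, contradicting the supremum.
  have hev : ∀ᶠ p in 𝓝 (sSup Q), rieszMat p e ∈ interior F :=
    (hcont e).continuousAt.eventually (isOpen_interior.mem_nhds hint)
  obtain ⟨δ, hδ, hball⟩ := Metric.eventually_nhds_iff.1 hev
  have hq := hball (y := sSup Q + δ / 2) (by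
    rw [Real.dist_eq, add_sub_cancel_left, abs_of_pos (by positivity)]; linarith)
  have hmem : sSup Q + δ / 2 ∈ Q := fun e' he' => by
    obtain ⟨g, hg, rfl⟩ := htrans e e' he he'
    rw [← conj_rieszMat]
    exact hG g hg _ (interior_subset hq)
  have := le_csSup hQb hmem
  linarith

/-! ### Annuli and spherical averages as deficits. -/

theorem isOpen_annulus (n : ℕ) (a : ℝ) (b : EReal) : IsOpen (annulus n a b) :=
  (isOpen_lt continuous_const continuous_norm).inter
    (isOpen_lt (continuous_coe_real_ereal.comp continuous_norm) continuous_const)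

/-- Values outside `X` are arbitrary; resetting them to `⊥` yields a Borel function, as Tonelli
requires. -/
theorem measurable_ite_of_upperSemicontinuousOn {n : ℕ} {X : Set (Rn n)} (hX : IsOpen X)
    {u : Rn n → EReal} (hu : UpperSemicontinuousOn u X) [DecidablePred (· ∈ X)] :
    Measurable fun x => if x ∈ X then u x else ⊥ := by
  refine measurable_of_Iio fun c => ?_
  by_cases hc : c = ⊥
  · simp [hc]
  have : (fun x => if x ∈ X then u x else ⊥) ⁻¹' Set.Iio c = Xᶜ ∪ {x ∈ X | u x < c} := by
    ext x
    by_cases hx : x ∈ X <;> simp [hx, bot_lt_iff_ne_bot, hc]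
  rw [this]
  refine hX.measurableSet.compl.union (IsOpen.measurableSet ?_)
  rw [isOpen_iff_mem_nhds]
  rintro x ⟨hx, hxc⟩
  have := hu x hx c hxc
  rw [hX.nhdsWithin_eq hx] at this
  exact Filter.inter_mem (hX.mem_nhds hx) this

/-- The spherical mean of `M - u`. -/
def sphereDeficit {n : ℕ} (M : ℝ) (u : Rn n → EReal) (t : ℝ) : ENNReal :=
  ∫⁻ σ : unitSphere n, ((M : EReal) - u (t • (σ : Rn n))).toENNReal ∂sphereMeasure n

theorem measurable_deficit {n : ℕ} {u : Rn n → EReal} (hu : Measurable u) (M : ℝ) :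
    Measurable fun x => ((M : EReal) - u x).toENNReal :=
  (continuous_sub_toENNReal M).measurable.comp hu

/-- Written without outer subtractions, the identity `e⁺ + (M - e) = M + e⁻` can be integrated even
when some terms are infinite. -/
theorem toENNReal_add_deficit {e : EReal} {M : ℝ} (hM : 0 ≤ M) (he : e ≤ M) :
    e.toENNReal + ((M : EReal) - e).toENNReal = ENNReal.ofReal M + (-e).toENNReal := by
  induction e using EReal.rec with
  | bot => simp
  | top => simp at he
  | coe x =>
    have hx : x ≤ M := by exact_mod_cast he
    rw [← EReal.coe_sub, ← EReal.coe_neg]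
    simp only [EReal.toENNReal_of_ne_top (EReal.coe_ne_top _), EReal.toReal_coe]
    rcases le_total 0 x with h | h
    · rw [← ENNReal.ofReal_add h (by linarith), ENNReal.ofReal_of_nonpos (p := -x) (by linarith)]
      simp
    · rw [← ENNReal.ofReal_add hM (by linarith), ENNReal.ofReal_of_nonpos (p := x) h, zero_add]
      congr 1

theorem sphericalAverage_eq {n : ℕ} [Nonempty (unitSphere n)] {u : Rn n → EReal}
    (hu : Measurable u) {M t : ℝ} (hM : 0 ≤ M) (huM : ∀ σ : unitSphere n, u (t • (σ : Rn n)) ≤ M) :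
    sphericalAverage u t = (M : EReal) - (sphereDeficit M u t : ENNReal) := by
  have hprob := isProbabilityMeasure_sphereMeasure (n := n)
  have hut : Measurable fun σ : unitSphere n => u (t • (σ : Rn n)) :=
    hu.comp ((continuous_const_smul t).comp continuous_subtype_val).measurable
  have hpos : Measurable fun σ : unitSphere n => (u (t • (σ : Rn n))).toENNReal :=
    EReal.continuous_toENNReal.measurable.comp hut
  have hsum : ∫⁻ σ : unitSphere n, (u (t • (σ : Rn n))).toENNReal ∂sphereMeasure n +
      sphereDeficit M u t = ENNReal.ofReal M +
      ∫⁻ σ : unitSphere n, (-u (t • (σ : Rn n))).toENNReal ∂sphereMeasure n := by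
    rw [sphereDeficit, ← lintegral_add_left hpos]
    simp only [toENNReal_add_deficit hM (huM _)]
    rw [lintegral_add_left measurable_const, lintegral_const, measure_univ, mul_one]
  have hle : ∫⁻ σ : unitSphere n, (u (t • (σ : Rn n))).toENNReal ∂sphereMeasure n ≤
      ENNReal.ofReal M := by
    calc _ ≤ ∫⁻ _ : unitSphere n, ENNReal.ofReal M ∂sphereMeasure n := by
          refine lintegral_mono fun σ => ?_
          have := EReal.toENNReal_le_toENNReal (huM σ)
          rwa [EReal.toENNReal_of_ne_top (EReal.coe_ne_top _), EReal.toReal_coe] at this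
      _ = _ := by rw [lintegral_const, measure_univ, mul_one]
  unfold sphericalAverage
  change ((∫⁻ σ : unitSphere n, (u (t • (σ : Rn n))).toENNReal ∂sphereMeasure n : ENNReal) : EReal)
    - ((∫⁻ σ : unitSphere n, (-u (t • (σ : Rn n))).toENNReal ∂sphereMeasure n : ENNReal) : EReal) = _
  generalize ∫⁻ σ : unitSphere n, (u (t • (σ : Rn n))).toENNReal ∂sphereMeasure n = P at *
  generalize ∫⁻ σ : unitSphere n, (-u (t • (σ : Rn n))).toENNReal ∂sphereMeasure n = Q at *
  generalize sphereDeficit M u t = D at *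
  have hPt : P ≠ ⊤ := (hle.trans_lt ENNReal.ofReal_lt_top).ne
  by_cases hQ : Q = ⊤
  · have hD : D = ⊤ := by
      rw [hQ, add_top, ENNReal.add_eq_top] at hsum
      exact hsum.resolve_left hPt
    rw [hQ, hD]
    lift P to NNReal using hPt
    rfl
  · have hD : D ≠ ⊤ := by
      rintro rfl
      rw [add_top] at hsum
      exact (ENNReal.add_ne_top.2 ⟨ENNReal.ofReal_ne_top, hQ⟩) hsum.symm
    lift P to NNReal using hPt
    lift Q to NNReal using hQ
    lift D to NNReal using hD
    have h : (P : ℝ) + D = M + Q := by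
      have := congrArg ENNReal.toReal hsum
      rw [ENNReal.toReal_add ENNReal.coe_ne_top ENNReal.coe_ne_top,
        ENNReal.toReal_add ENNReal.ofReal_ne_top ENNReal.coe_ne_top, ENNReal.toReal_ofReal hM] at this
      exact this
    change ((P : ℝ) : EReal) - ((Q : ℝ) : EReal) = (M : EReal) - ((D : ℝ) : EReal)
    rw [← EReal.coe_sub, ← EReal.coe_sub]
    congr 1
    linarith

theorem act_mem_annulus {n : ℕ} {a : ℝ} {b : EReal} {x : Rn n} (hx : x ∈ annulus n a b)
    (g : Matrix.orthogonalGroup (Fin n) ℝ) : act g x ∈ annulus n a b := by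
  simpa only [annulus, Set.mem_ofPred_eq, norm_act] using hx

theorem lintegral_lintegral_act_swap {n : ℕ} {ν : Measure (Matrix.orthogonalGroup (Fin n) ℝ)}
    [IsProbabilityMeasure ν] {μ : Measure (unitSphere n)} [IsProbabilityMeasure μ]
    {D : Rn n → ENNReal} (hD : Measurable D) {c : Matrix.orthogonalGroup (Fin n) ℝ → unitSphere n → Rn n}
    (hc : Continuous fun q : Matrix.orthogonalGroup (Fin n) ℝ × unitSphere n => c q.1 q.2) :
    ∫⁻ g, ∫⁻ σ : unitSphere n, D (c g σ) ∂μ ∂ν = ∫⁻ σ : unitSphere n, ∫⁻ g, D (c g σ) ∂ν ∂μ :=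
  lintegral_lintegral_swap (hD.comp hc.measurable).aemeasurable

/-! ### Mean value properties of subharmonic functions. -/

section MeanValue

variable {n : ℕ} [Nonempty (unitSphere n)] {F : Set (SymMat n)} (hcone : IsCone F)
  {Γ : Subgroup (Matrix.orthogonalGroup (Fin n) ℝ)} (hΓ : ∀ g ∈ Γ, ∀ A ∈ F, conj g A ∈ F)
  {ν : Measure (Matrix.orthogonalGroup (Fin n) ℝ)} [IsProbabilityMeasure ν]
  (hνΓ : ∀ᵐ g ∂ν, g ∈ Γ)
  (hν : ∀ D : Rn n → ENNReal, Measurable D → ∀ y,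
    ∫⁻ g, D (act g y) ∂ν = ∫⁻ σ : unitSphere n, D (‖y‖ • (σ : Rn n)) ∂sphereMeasure n)
  {ℓ : Matrix (Fin n) (Fin n) ℝ →ₗ[ℝ] ℝ} (hI : 0 < ℓ 1)
  (hP : ∀ P : Matrix (Fin n) (Fin n) ℝ, P.PosSemidef → 0 ≤ ℓ P)
  (hℓF : ∀ A ∈ F, 0 ≤ ℓ (A : Matrix (Fin n) (Fin n) ℝ))
  {μ : Measure (unitSphere n)} [IsProbabilityMeasure μ]
  (hμ : ∀ H, polyOp ℓ H = 0 → ∫ σ : unitSphere n, polyFun H σ ∂μ = polyFun H 0)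

include hcone hΓ hI hP hℓF hμ in
-- Pulling back by the similarity `y ↦ x + r g y` reduces this to the unit ball, where the linear
-- mean value inequality applies.
theorem IsSubharmonic.lintegral_similarity_le {X : Set (Rn n)} {v : Rn n → EReal}
    (hv : IsSubharmonic F X v) {g : Matrix.orthogonalGroup (Fin n) ℝ} (hg : g ∈ Γ) {x : Rn n}
    {r : ℝ} (hr : 0 < r) (hX : Metric.closedBall x r ⊆ X) {M : ℝ}
    (hM : ∀ y ∈ Metric.closedBall x r, v y ≤ M) :
    ∫⁻ σ : unitSphere n, ((M : EReal) - v (x + r • act g σ)).toENNReal ∂μ ≤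
      ((M : EReal) - v x).toENNReal := by
  have hsub := hv.comp_similarity hcone (g := g) (fun A hA => hΓ _ (Γ.inv_mem hg) A hA) x hr
  have hball : ∀ y ∈ Metric.closedBall (0 : Rn n) 1, x + r • act g y ∈ Metric.closedBall x r := by
    intro y hy
    rw [mem_closedBall_zero_iff] at hy
    rw [Metric.mem_closedBall, dist_eq_norm, add_sub_cancel_left, norm_smul, norm_act,
      Real.norm_of_nonneg hr.le]
    nlinarith
  have h := IsLinSub.lintegral_le hI hμ hP (w := fun y => v (x + r • act g y)) (M := M)
    (hsub.usc.mono fun y hy => hX (hball y hy))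
    (fun y hy => hsub.isLinSub hℓF y (hX (hball y (Metric.ball_subset_closedBall hy))))
    (fun y hy => hM _ (hball y hy))
  have h0 : act g (0 : Rn n) = 0 := map_zero (Matrix.toEuclideanLin (g : Matrix (Fin n) (Fin n) ℝ))
  simpa [h0] using h

include hcone hΓ hI hP hℓF hμ hνΓ hν in
/-- The sub-mean value property on spheres. -/
theorem IsSubharmonic.lintegral_sphere_le {X : Set (Rn n)} {v : Rn n → EReal}
    (hv : IsSubharmonic F X v) (hvm : Measurable v) {x : Rn n}
    {r : ℝ} (hr : 0 < r) (hX : Metric.closedBall x r ⊆ X) {M : ℝ}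
    (hM : ∀ y ∈ Metric.closedBall x r, v y ≤ M) :
    ∫⁻ σ : unitSphere n, ((M : EReal) - v (x + r • (σ : Rn n))).toENNReal ∂sphereMeasure n ≤
      ((M : EReal) - v x).toENNReal := by
  have hD := measurable_deficit hvm M
  have hc : Continuous fun y : Rn n => x + r • y := by fun_prop
  -- For each unit `σ`, the average over `g` is the full spherical mean about `x`. It no longer
  -- depends on `σ`, so the possibly anisotropic `μ` drops out.
  calc _ = ∫⁻ σ : unitSphere n, ∫⁻ g, ((M : EReal) - v (x + r • act g σ)).toENNReal ∂ν ∂μ := by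
        have h : ∀ σ : unitSphere n, ∫⁻ g, ((M : EReal) - v (x + r • act g σ)).toENNReal ∂ν =
            ∫⁻ σ : unitSphere n, ((M : EReal) - v (x + r • (σ : Rn n))).toENNReal
              ∂sphereMeasure n := by
          intro σ
          have h1 := hν (fun y => ((M : EReal) - v (x + r • y)).toENNReal)
            (hD.comp hc.measurable) σ
          simpa [mem_sphere_zero_iff_norm.1 σ.2] using h1
        rw [lintegral_congr h, lintegral_const, measure_univ, mul_one]
    _ = ∫⁻ g, ∫⁻ σ : unitSphere n, ((M : EReal) - v (x + r • act g σ)).toENNReal ∂μ ∂ν := by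
        refine (lintegral_lintegral_act_swap hD (c := fun g σ => x + r • act g σ) ?_).symm
        exact hc.comp (continuous_act_uncurry.comp
          (continuous_fst.prodMk (continuous_subtype_val.comp continuous_snd)))
    _ ≤ ∫⁻ _ : Matrix.orthogonalGroup (Fin n) ℝ, ((M : EReal) - v x).toENNReal ∂ν := by
        refine lintegral_mono_ae ?_
        filter_upwards [hνΓ] with g hg
        exact hv.lintegral_similarity_le hcone hΓ hI hP hℓF hμ hg hr hX hM
    _ = _ := by rw [lintegral_const, measure_univ, mul_one]

include hcone hΓ hI hP hℓF hμ hνΓ hν in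
/-- Spherical averages of subharmonic functions inherit the sub-mean value property. -/
theorem IsSubharmonic.lintegral_sphereDeficit_le {a : ℝ} {b : EReal} {v : Rn n → EReal}
    (hv : IsSubharmonic F (annulus n a b) v) (hvm : Measurable v) {x : Rn n}
    {r : ℝ} (hr : 0 < r) (hX : Metric.closedBall x r ⊆ annulus n a b) {M : ℝ}
    (hM : ∀ g : Matrix.orthogonalGroup (Fin n) ℝ, ∀ y ∈ Metric.closedBall x r, v (act g y) ≤ M) :
    ∫⁻ σ : unitSphere n, sphereDeficit M v ‖x + r • (σ : Rn n)‖ ∂μ ≤ sphereDeficit M v ‖x‖ := by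
  have hD := measurable_deficit hvm M
  -- Here the rotations are about the origin: for each `g` the inequality holds on the ball about `g
  -- x`, and integrating over `g` produces averages over centred spheres.
  calc _ = ∫⁻ σ : unitSphere n, ∫⁻ g, ((M : EReal) - v (act g (x + r • (σ : Rn n)))).toENNReal ∂ν ∂μ :=
        lintegral_congr fun σ => (hν _ hD _).symm
    _ = ∫⁻ g, ∫⁻ σ : unitSphere n, ((M : EReal) - v (act g (x + r • (σ : Rn n)))).toENNReal ∂μ ∂ν := by
        refine (lintegral_lintegral_act_swap hD (c := fun g σ => act g (x + r • (σ : Rn n))) ?_).symm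
        refine continuous_act_uncurry.comp (continuous_fst.prodMk ?_)
        have hc : Continuous fun y : Rn n => x + r • y := by fun_prop
        exact hc.comp (continuous_subtype_val.comp continuous_snd)
    _ ≤ ∫⁻ g, ((M : EReal) - v (act g x)).toENNReal ∂ν := by
        refine lintegral_mono_ae ?_
        filter_upwards [hνΓ] with g hg
        have hball : ∀ y ∈ Metric.closedBall (act g x) r, ∃ z ∈ Metric.closedBall x r, y = act g z := by
          intro y hy
          refine ⟨act g⁻¹ y, ?_, (act_act_inv g y).symm⟩
          rw [Metric.mem_closedBall] at hy ⊢
          have h1 : dist (act g⁻¹ y) x = dist y (act g x) := by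
            have := (actIsometry g).dist_map (act g⁻¹ y) x
            rw [← this]
            change dist (act g (act g⁻¹ y)) (act g x) = _
            rw [act_act_inv]
          rwa [h1]
        have := hv.lintegral_similarity_le hcone hΓ hI hP hℓF hμ hg hr (x := act g x) (M := M)
          (fun y hy => by
            obtain ⟨z, hz, rfl⟩ := hball y hy
            exact act_mem_annulus (hX hz) g)
          (fun y hy => by
            obtain ⟨z, hz, rfl⟩ := hball y hy
            exact hM g z hz)
        simpa only [act_add, act_smul] using this
    _ = _ := hν _ hD _

end MeanValue

/-! ### Radial solutions and strict supersolutions. -/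

/-- The exponent is chosen so that `2 q k'' = -p k'`, which makes the Hessian of `k (|x|²)`
proportional to `I - p e eᵀ` with `e = x / |x|`. The logarithm is the case `p = 2`. -/
theorem exists_radialSolution (p : ℝ) :
    ∃ k : ℝ → ℝ, ∀ q, 0 < q → ContDiffAt ℝ 2 k q ∧ HasDerivAt k (q ^ (-p / 2)) q := by
  by_cases hp : -p / 2 = -1
  · refine ⟨Real.log, fun q hq => ⟨Real.contDiffAt_log.2 hq.ne', ?_⟩⟩
    rw [hp, Real.rpow_neg_one]
    exact Real.hasDerivAt_log hq.ne'
  · have hp' : -p / 2 + 1 ≠ 0 := fun h => hp (by linarith)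
    refine ⟨fun q => q ^ (-p / 2 + 1) / (-p / 2 + 1), fun q hq =>
      ⟨(Real.contDiffAt_rpow_const_of_ne hq.ne').div_const _, ?_⟩⟩
    have := (Real.hasDerivAt_rpow_const (p := -p / 2 + 1) (Or.inl hq.ne')).div_const (-p / 2 + 1)
    refine this.congr_deriv ?_
    rw [add_sub_cancel_right]
    exact mul_div_cancel_left₀ _ hp'

section Radial

variable {n : ℕ} {p : ℝ} {k : ℝ → ℝ}
  (hk : ∀ q, 0 < q → ContDiffAt ℝ 2 k q ∧ HasDerivAt k (q ^ (-p / 2)) q)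

include hk

theorem contDiffAt_radialSolution {x : Rn n} (hx : x ≠ 0) (α c ε : ℝ) :
    ContDiffAt ℝ 2 (fun y : Rn n => α * k (‖y‖ ^ 2) + (c + -ε * ‖y‖ ^ 2)) x := by
  have hq : 0 < ‖x‖ ^ 2 := by positivity
  exact (contDiffAt_const.mul ((hk _ hq).1.comp x (contDiff_norm_sq ℝ).contDiffAt)).add
    (contDiffAt_const.add (contDiff_mul_norm_sq _).contDiffAt)

theorem hessian_radialSolution {x : Rn n} (hx : x ≠ 0) (α c ε : ℝ) :
    hessian (fun y : Rn n => α * k (‖y‖ ^ 2) + (c + -ε * ‖y‖ ^ 2)) x =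
      (α * (2 * (‖x‖ ^ 2) ^ (-p / 2))) •
        (rieszMat p (‖x‖⁻¹ • x) : Matrix (Fin n) (Fin n) ℝ) + (2 * -ε) • 1 := by
  have hq : 0 < ‖x‖ ^ 2 := by positivity
  have h1 : hessian (fun y : Rn n => k (‖y‖ ^ 2)) x =
      (2 * (‖x‖ ^ 2) ^ (-p / 2)) • (rieszMat p (‖x‖⁻¹ • x) : Matrix (Fin n) (Fin n) ℝ) := by
    rw [hessian_radial (K1 := fun q => q ^ (-p / 2))
      (by filter_upwards [lt_mem_nhds hq] with q hq' using (hk q hq').2)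
      (Real.hasDerivAt_rpow_const (Or.inl hq.ne'))]
    have h2 : (‖x‖ ^ 2) ^ (-p / 2 - 1) = (‖x‖ ^ 2) ^ (-p / 2) / ‖x‖ ^ 2 := by
      rw [Real.rpow_sub_one hq.ne']
    rw [h2]
    ext i j
    have hx' : ‖x‖ ≠ 0 := norm_ne_zero_iff.2 hx
    simp only [rieszMat, Matrix.add_apply, Matrix.smul_apply, Matrix.sub_apply,
      Matrix.vecMulVec_apply, PiLp.smul_apply, smul_eq_mul, Matrix.one_apply]
    field_simp
    ring
  have hkc : ContDiffAt ℝ 2 (fun y : Rn n => k (‖y‖ ^ 2)) x :=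
    (hk _ hq).1.comp x (contDiff_norm_sq ℝ).contDiffAt
  rw [hessian_add (contDiffAt_const.mul hkc)
    (contDiffAt_const.add (contDiff_mul_norm_sq _).contDiffAt), hessian_smul hkc,
    hessian_add contDiffAt_const (contDiff_mul_norm_sq _).contDiffAt, hessian_const,
    hessian_mul_norm_sq, h1, zero_add, smul_smul]

end Radial

theorem continuousAt_linear_hessian {n : ℕ} (ℓ : Matrix (Fin n) (Fin n) ℝ →ₗ[ℝ] ℝ)
    {φ : Rn n → ℝ} {x : Rn n} (hφ : ContDiffAt ℝ 2 φ x) :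
    ContinuousAt (fun y => ℓ (hessian φ y)) x := by
  have h : ContinuousAt (fderiv ℝ (fderiv ℝ φ)) x :=
    ((hφ.fderiv_right (m := 1) (by norm_num)).fderiv_right (m := 0) (by norm_num)).continuousAt
  have : (fun y => ℓ (hessian φ y)) = fun y => ∑ i, ∑ j, ℓ (Matrix.single i j 1) *
      fderiv ℝ (fderiv ℝ φ) y (EuclideanSpace.single i 1) (EuclideanSpace.single j 1) := by
    ext y; rw [linearMap_matrix_apply]; rfl
  rw [this]
  refine tendsto_finsetSum _ fun i _ => tendsto_finsetSum _ fun j _ => ?_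
  exact ((h.clm_apply continuousAt_const).clm_apply continuousAt_const).const_mul _

/-- A strict smooth supersolution has the strict super-mean value property. -/
theorem eventually_integral_lt {n : ℕ} [Nonempty (unitSphere n)]
    {ℓ : Matrix (Fin n) (Fin n) ℝ →ₗ[ℝ] ℝ} (hI : 0 < ℓ 1)
    {μ : Measure (unitSphere n)} [IsProbabilityMeasure μ]
    (hμ : ∀ H, polyOp ℓ H = 0 → ∫ σ : unitSphere n, polyFun H σ ∂μ = polyFun H 0)
    (hP : ∀ P : Matrix (Fin n) (Fin n) ℝ, P.PosSemidef → 0 ≤ ℓ P)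
    {φ : Rn n → ℝ} {x : Rn n} (hφ : ContDiffAt ℝ 2 φ x) (hneg : ℓ (hessian φ x) < 0) :
    ∀ᶠ r in 𝓝[>] (0 : ℝ), Continuous (fun σ : unitSphere n => φ (x + r • (σ : Rn n))) ∧
      ∫ σ : unitSphere n, φ (x + r • (σ : Rn n)) ∂μ < φ x := by
  obtain ⟨η, hη, hηneg⟩ : ∃ η : ℝ, 0 < η ∧ ℓ (hessian φ x) + 2 * η * ℓ 1 < 0 := by
    -- This choice spends exactly half of the negativity of `ℓ (hessian φ x)`.
    refine ⟨-ℓ (hessian φ x) / (4 * ℓ 1), div_pos (by linarith) (by positivity), ?_⟩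
    field_simp
    linarith
  have hev : ∀ᶠ y in 𝓝 x, ContDiffAt ℝ 2 φ y ∧ ℓ (hessian φ y) + 2 * η * ℓ 1 < 0 :=
    (hφ.eventually (by simp)).and
      (((continuousAt_linear_hessian ℓ hφ).add continuousAt_const).eventually
        (gt_mem_nhds hηneg))
  obtain ⟨r₀, hr₀, hball⟩ := Metric.eventually_nhds_iff.1 hev
  filter_upwards [Ioo_mem_nhdsGT hr₀] with r hr
  have hmem : ∀ y ∈ Metric.closedBall (0 : Rn n) 1, dist (x + r • y) x < r₀ := fun y hy => by
    rw [mem_closedBall_zero_iff] at hy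
    rw [dist_eq_norm, add_sub_cancel_left, norm_smul, Real.norm_of_nonneg hr.1.le]
    nlinarith [hr.1, hr.2]
  have hlin : ∀ y : Rn n, Matrix.toEuclideanLin (r • (1 : Matrix (Fin n) (Fin n) ℝ)) y = r • y :=
    fun y => by simp [Matrix.toLpLin_one]
  have hC : ∀ y ∈ Metric.closedBall (0 : Rn n) 1, ContDiffAt ℝ 2 (fun y => φ (x + r • y)) y :=
    fun y hy => (hball (hmem y hy)).1.comp y
      (contDiffAt_const.add (contDiffAt_id.const_smul r))
  have hH : ∀ y ∈ Metric.closedBall (0 : Rn n) 1,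
      hessian (fun y => φ (x + r • y)) y = (r ^ 2) • hessian φ (x + r • y) := fun y hy => by
    have := hessian_comp_affine (φ := φ) (b := x) (x := y) (r • (1 : Matrix (Fin n) (Fin n) ℝ))
      (by rw [hlin]; exact (hball (hmem y hy)).1)
    simp only [hlin] at this
    rw [this]
    simp [smul_smul, sq]
  -- The quadratic term vanishes at the centre and equals `-η r²` on the sphere; that difference
  -- supplies the strictness. The slack from `η` keeps `ψ` a subsolution.
  set ψ : Rn n → ℝ := fun y => -φ (x + r • y) + -(η * r ^ 2) * ‖y‖ ^ 2
  have hψC : ∀ y ∈ Metric.closedBall (0 : Rn n) 1, ContDiffAt ℝ 2 ψ y := fun y hy =>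
    (hC y hy).neg.add (contDiff_mul_norm_sq _).contDiffAt
  have hψcont : ContinuousOn ψ (Metric.closedBall 0 1) := fun y hy =>
    (hψC y hy).continuousAt.continuousWithinAt
  have hψsub : IsLinSub ℓ (Metric.ball 0 1) fun y => (ψ y : EReal) := by
    refine isLinSub_of_contDiff hP (fun y hy => hψC y (Metric.ball_subset_closedBall hy))
      fun y hy => ?_
    have hy' := Metric.ball_subset_closedBall hy
    rw [hessian_add (hC y hy').neg (contDiff_mul_norm_sq _).contDiffAt, hessian_neg (hC y hy'),
      hH y hy', hessian_mul_norm_sq]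
    simp only [map_add, map_neg, map_smul, smul_eq_mul]
    have h1 := (hball (hmem y hy')).2
    nlinarith [sq_nonneg r]
  obtain ⟨M, hM⟩ := (isCompact_closedBall (0 : Rn n) 1).bddAbove_image hψcont
  have hM' : ∀ y ∈ Metric.closedBall (0 : Rn n) 1, ψ y ≤ M := fun y hy =>
    hM (Set.mem_image_of_mem _ hy)
  have hle := IsLinSub.lintegral_le hI hμ hP (w := fun y => (ψ y : EReal)) (M := M)
    (continuous_coe_real_ereal.comp_continuousOn hψcont).upperSemicontinuousOn hψsub
    (fun y hy => by exact_mod_cast hM' y hy)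
  have hsph : ∀ σ : unitSphere n, (σ : Rn n) ∈ Metric.closedBall (0 : Rn n) 1 := fun σ =>
    Metric.sphere_subset_closedBall σ.2
  have hcont : Continuous fun σ : unitSphere n => φ (x + r • (σ : Rn n)) :=
    continuous_iff_continuousAt.2 fun σ =>
      ((hC _ (hsph σ)).continuousAt).comp continuous_subtype_val.continuousAt
  have hint : ∀ f : unitSphere n → ℝ, Continuous f → Integrable f μ := fun f hf =>
    hf.integrable_of_hasCompactSupport (HasCompactSupport.of_compactSpace _)
  refine ⟨hcont, ?_⟩
  have hψσ : ∀ σ : unitSphere n, M - ψ σ = φ (x + r • (σ : Rn n)) + (M + η * r ^ 2) := fun σ => by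
    simp only [ψ, mem_sphere_zero_iff_norm.1 σ.2]
    ring
  simp only [← EReal.coe_sub, EReal.toENNReal_of_ne_top (EReal.coe_ne_top _), EReal.toReal_coe]
    at hle
  rw [← ofReal_integral_eq_lintegral_ofReal, ENNReal.ofReal_le_ofReal_iff] at hle
  · simp only [hψσ] at hle
    rw [integral_add (hint _ hcont) (integrable_const _)] at hle
    simp only [integral_const, probReal_univ, smul_eq_mul, one_mul, ψ, smul_zero, add_zero,
      norm_zero] at hle
    have : 0 < η * r ^ 2 := mul_pos hη (pow_pos hr.1 2)
    linarith
  · linarith [hM' 0 (by simp)]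
  · simp only [hψσ]
    exact hint _ (hcont.add continuous_const)
  · exact Filter.Eventually.of_forall fun σ => sub_nonneg.2 (hM' _ (hsph σ))

/-! ### Shells and semicontinuity of averages. -/

/-- The closed shell `{s₁ ≤ |y| ≤ s₂}`. -/
def shell (n : ℕ) (s₁ s₂ : ℝ) : Set (Rn n) := {y | s₁ ≤ ‖y‖ ∧ ‖y‖ ≤ s₂}

theorem isCompact_shell (n : ℕ) (s₁ s₂ : ℝ) : IsCompact (shell n s₁ s₂) := by
  refine (isCompact_closedBall (0 : Rn n) s₂).of_isClosed_subset ?_ fun y hy => by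
    simpa using hy.2
  exact (isClosed_le continuous_const continuous_norm).inter
    (isClosed_le continuous_norm continuous_const)

theorem shell_subset_annulus {n : ℕ} {a s₁ s₂ : ℝ} {b : EReal} (h1 : a < s₁) (h2 : (s₂ : EReal) < b) :
    shell n s₁ s₂ ⊆ annulus n a b := fun _ hy =>
  ⟨h1.trans_le hy.1, (EReal.coe_le_coe_iff.2 hy.2).trans_lt h2⟩

theorem exists_bound {n : ℕ} {K : Set (Rn n)} (hK : IsCompact K) {u : Rn n → EReal}
    (hu : UpperSemicontinuousOn u K) (hlt : ∀ y ∈ K, u y < ⊤) :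
    ∃ M : ℝ, 0 ≤ M ∧ ∀ y ∈ K, u y ≤ M := by
  rcases K.eq_empty_or_nonempty with rfl | hne
  · exact ⟨0, le_rfl, by simp⟩
  obtain ⟨z, hz, hmax⟩ := hu.exists_isMaxOn hne hK
  obtain ⟨M, hM, -⟩ := EReal.lt_iff_exists_real_btwn.1 (hlt z hz)
  refine ⟨max M 0, le_max_right _ _, fun y hy => (hmax hy).trans (hM.le.trans ?_)⟩
  exact_mod_cast le_max_left _ _

/-- Fatou's lemma along the neighbourhood filter of `x`, applied to the lower semicontinuous
integrand for each fixed `σ`. -/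
theorem lowerSemicontinuousAt_sphereDeficit {n : ℕ} {a : ℝ} {b : EReal} {v : Rn n → EReal}
    (hv : UpperSemicontinuousOn v (annulus n a b)) (hvm : Measurable v) (M : ℝ) {x : Rn n}
    (hx : x ∈ annulus n a b) : LowerSemicontinuousAt (fun x => sphereDeficit M v ‖x‖) x := by
  rw [lowerSemicontinuousAt_iff_le_liminf]
  have hm : ∀ y : Rn n, Measurable fun σ : unitSphere n =>
      ((M : EReal) - v (‖y‖ • (σ : Rn n))).toENNReal := fun y =>
    (measurable_deficit hvm M).comp ((continuous_const_smul _).comp continuous_subtype_val).measurable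
  refine le_trans (lintegral_mono fun σ => ?_) (lintegral_liminf_le (u := 𝓝 x) hm)
  have hz : ‖x‖ • (σ : Rn n) ∈ annulus n a b := by
    have : ‖‖x‖ • (σ : Rn n)‖ = ‖x‖ := by
      rw [norm_smul, norm_norm, mem_sphere_zero_iff_norm.1 σ.2, mul_one]
    simpa only [annulus, Set.mem_ofPred_eq, this] using hx
  have hl := lowerSemicontinuousOn_sub_toENNReal hv M _ hz
  have hl' : LowerSemicontinuousAt (fun y => ((M : EReal) - v y).toENNReal) (‖x‖ • (σ : Rn n)) := by
    intro c hc
    have := hl c hc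
    rwa [(isOpen_annulus n a b).nhdsWithin_eq hz] at this
  have hc : ContinuousAt (fun y : Rn n => ‖y‖ • (σ : Rn n)) x := by fun_prop
  have h : LowerSemicontinuousAt
      (fun y : Rn n => ((M : EReal) - v (‖y‖ • (σ : Rn n))).toENNReal) x :=
    fun c hcc => hc.eventually (hl' c hcc)
  exact lowerSemicontinuousAt_iff_le_liminf.1 h

theorem ofReal_le_of_coe_sub_le {M r : ℝ} {D : ENNReal} (h : (M : EReal) - (D : EReal) ≤ r) :
    ENNReal.ofReal (M - r) ≤ D := by
  by_cases hD : D = ⊤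
  · simp [hD]
  lift D to NNReal using hD
  change (M : EReal) - ((D : ℝ) : EReal) ≤ r at h
  rw [← EReal.coe_sub, EReal.coe_le_coe_iff] at h
  rw [ENNReal.ofReal_le_iff_le_toReal ENNReal.coe_ne_top, ENNReal.coe_toReal]
  linarith

theorem eq_ofReal_of_coe_sub_eq {M r : ℝ} {D : ENNReal} (h : (M : EReal) - (D : EReal) = r) :
    D = ENNReal.ofReal (M - r) ∧ 0 ≤ M - r := by
  by_cases hD : D = ⊤
  · subst hD
    have h' : (⊥ : EReal) = r := h
    exact absurd h'.symm (EReal.coe_ne_bot _)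
  lift D to NNReal using hD
  change (M : EReal) - ((D : ℝ) : EReal) = r at h
  rw [← EReal.coe_sub, EReal.coe_eq_coe_iff] at h
  have : M - r = D := by linarith
  rw [this]
  exact ⟨by simp, D.2⟩

theorem upperSemicontinuousOn_sphericalAverage {n : ℕ} [Nonempty (unitSphere n)] {a : ℝ}
    {b : EReal} {v : Rn n → EReal} (hv : UpperSemicontinuousOn v (annulus n a b))
    (hvm : Measurable v) {M s₁ s₂ : ℝ} (hM : 0 ≤ M) (hs : shell n s₁ s₂ ⊆ annulus n a b)
    (hvM : ∀ y ∈ shell n s₁ s₂, v y ≤ M) :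
    UpperSemicontinuousOn (fun x => sphericalAverage v ‖x‖) (shell n s₁ s₂) := by
  have hcont : Continuous fun d : ENNReal => (M : EReal) - (d : EReal) := by
    have h : Continuous fun e : EReal => (M : EReal) + -e := continuous_iff_continuousAt.2 fun e =>
      (EReal.continuousAt_add (p := ((M : EReal), -e)) (Or.inl (EReal.coe_ne_top _))
        (Or.inl (EReal.coe_ne_bot _))).comp (f := fun e : EReal => ((M : EReal), -e))
        (continuousAt_const.prodMk continuous_neg.continuousAt)
    simp only [sub_eq_add_neg]
    exact h.comp continuous_coe_ennreal_ereal
  have hanti : Antitone fun d : ENNReal => (M : EReal) - (d : EReal) := fun d e hde =>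
    EReal.sub_le_sub le_rfl (EReal.coe_ennreal_le_coe_ennreal_iff.2 hde)
  have hlsc : LowerSemicontinuousOn (fun x => sphereDeficit M v ‖x‖) (shell n s₁ s₂) := fun x hx =>
    (lowerSemicontinuousAt_sphereDeficit hv hvm M (hs hx)).lowerSemicontinuousWithinAt _
  have h := hcont.comp_lowerSemicontinuousOn_antitone hlsc hanti
  have heq : ∀ x ∈ shell n s₁ s₂, sphericalAverage v ‖x‖ =
      (M : EReal) - (sphereDeficit M v ‖x‖ : ENNReal) := fun x hx =>
    sphericalAverage_eq hvm hM fun σ => hvM _ (by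
      have : ‖‖x‖ • (σ : Rn n)‖ = ‖x‖ := by
        rw [norm_smul, norm_norm, mem_sphere_zero_iff_norm.1 σ.2, mul_one]
      simpa only [shell, Set.mem_ofPred_eq, this] using hx)
  intro x hx c hc
  have hc' : (M : EReal) - (sphereDeficit M v ‖x‖ : ENNReal) < c := by rwa [← heq x hx]
  filter_upwards [h x hx c hc', self_mem_nhdsWithin] with y hy hys
  rw [heq y hys]
  exact hy

theorem mem_shell_boundary {n : ℕ} {t₁ t₂ : ℝ} {y : Rn n}
    (hy : y ∈ shell n t₁ t₂ \ {y | t₁ < ‖y‖ ∧ ‖y‖ < t₂}) : ‖y‖ = t₁ ∨ ‖y‖ = t₂ := by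
  obtain ⟨⟨h1, h2⟩, h3⟩ := hy
  simp only [Set.mem_ofPred_eq, not_and_or, not_lt] at h3
  rcases h3 with h3 | h3
  · exact Or.inl (le_antisymm h3 h1)
  · exact Or.inr (le_antisymm h2 h3)

/-! ### Comparison with radial solutions on a shell. -/

section Comparison

variable {n : ℕ} [Nonempty (unitSphere n)] {F : Set (SymMat n)} {p : ℝ} {k : ℝ → ℝ}
  (hk : ∀ q, 0 < q → ContDiffAt ℝ 2 k q ∧ HasDerivAt k (q ^ (-p / 2)) q)
  {a : ℝ} {b : EReal} (ha : 0 ≤ a) {t₁ t₂ : ℝ} (ht₁ : a < t₁) (ht₂ : (t₂ : EReal) < b)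
  {α c : ℝ} (hα : 0 ≤ α)

include hk ha ht₁ ht₂ hα

/-- Radial solutions which lie below a dual-subharmonic radial function on the boundary of a shell
lie below it inside. -/
theorem IsSubharmonic.radial_le {h : ℝ → EReal} (hF : IsSubequation F) (hcone : IsCone F)
    (hp : ∀ e : Rn n, ‖e‖ = 1 → rieszMat p e ∈ F)
    (hh : IsSubharmonic (dual F) (annulus n a b) fun x => -h ‖x‖)
    (hb₁ : ((α * k (t₁ ^ 2) + c : ℝ) : EReal) ≤ h t₁)
    (hb₂ : ((α * k (t₂ ^ 2) + c : ℝ) : EReal) ≤ h t₂) {t : ℝ} (ht : t ∈ Set.Icc t₁ t₂) :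
    ((α * k (t ^ 2) + c : ℝ) : EReal) ≤ h t := by
  by_contra! hcon
  obtain ⟨σ⟩ := ‹Nonempty (unitSphere n)›
  have hσ := mem_sphere_zero_iff_norm.1 σ.2
  have ht₁0 : 0 < t₁ := ha.trans_lt ht₁
  have ht0 : 0 < t := ht₁0.trans_le ht.1
  have hnorm : ‖t • (σ : Rn n)‖ = t := by rw [norm_smul, hσ, mul_one, Real.norm_of_nonneg ht0.le]
  obtain ⟨d, hd1, hd2⟩ := EReal.lt_iff_exists_real_btwn.1 hcon
  have hd2' : d < α * k (t ^ 2) + c := by exact_mod_cast hd2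
  -- The barrier for `-h` is `-(α k + c) + ε (t₂² - |y|²)`. The added term is nonnegative on the
  -- shell, and `ε` is small enough to keep the barrier at most `-d` at radius `t`.
  obtain ⟨ε, hε, hεd⟩ : ∃ ε : ℝ, 0 < ε ∧ ε * t₂ ^ 2 ≤ α * k (t ^ 2) + c - d := by
    have h2 : 0 < t₂ ^ 2 := pow_pos (ht0.trans_le ht.2) 2
    exact ⟨(α * k (t ^ 2) + c - d) / t₂ ^ 2, div_pos (by linarith) h2,
      by rw [div_mul_cancel₀ _ h2.ne']⟩
  have hne : ∀ y ∈ shell n t₁ t₂, y ≠ 0 := fun y hy h0 => by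
    have := hy.1
    rw [h0, norm_zero] at this
    linarith
  set φ : ℝ → Rn n → ℝ := fun e y => -α * k (‖y‖ ^ 2) + (e + -ε * ‖y‖ ^ 2)
  have hsub := shell_subset_annulus (n := n) ht₁ ht₂
  obtain ⟨x, ⟨hxK, hxO⟩, m, -, hxm, hle⟩ := exists_touching (O := {y | t₁ < ‖y‖ ∧ ‖y‖ < t₂})
    (isCompact_shell n t₁ t₂) (hh.usc.mono hsub) (fun y hy => hh.lt_top y (hsub hy))
    (φ := φ (-c + ε * t₂ ^ 2))
    (fun y hy => (contDiffAt_radialSolution hk (hne y hy) _ _ _).continuousAt.continuousWithinAt)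
    (by
      intro y hy
      have hneg : ∀ r : ℝ, ((α * k (r ^ 2) + c : ℝ) : EReal) ≤ h r →
          -h r ≤ ((-(α * k (r ^ 2) + c) : ℝ) : EReal) := fun r hr => by
        rw [EReal.coe_neg]
        exact EReal.neg_le_neg_iff.2 hr
      rcases mem_shell_boundary hy with hy' | hy'
      · simp only [φ, hy']
        refine (hneg _ hb₁).trans (EReal.coe_le_coe_iff.2 ?_)
        have : ε * t₁ ^ 2 ≤ ε * t₂ ^ 2 := by
          have := ht.1.trans ht.2
          gcongr
        linarith
      · simp only [φ, hy']
        refine (hneg _ hb₂).trans (EReal.coe_le_coe_iff.2 ?_)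
        linarith)
    (x₀ := t • (σ : Rn n)) (by simpa only [shell, Set.mem_ofPred_eq, hnorm, Set.mem_Icc] using ht)
    (by
      simp only [φ, hnorm]
      refine lt_of_le_of_lt (b := ((-d : ℝ) : EReal)) (EReal.coe_le_coe_iff.2 ?_) ?_
      · have : 0 ≤ ε * t ^ 2 := by positivity
        linarith
      · rw [EReal.coe_neg]
        exact EReal.neg_lt_neg_iff.2 hd1)
  have hopen : IsOpen {y : Rn n | t₁ < ‖y‖ ∧ ‖y‖ < t₂} :=
    (isOpen_lt continuous_const continuous_norm).inter (isOpen_lt continuous_norm continuous_const)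
  have hx0 := hne x hxK
  have hadd : ∀ y, φ (-c + ε * t₂ ^ 2) y + m = φ (-c + ε * t₂ ^ 2 + m) y := fun y => by
    simp only [φ]; ring
  obtain ⟨B, hB, hBh⟩ := hh.viscosity x (hsub hxK) (φ (-c + ε * t₂ ^ 2 + m))
    (contDiffAt_radialSolution hk hx0 _ _ _)
    (by
      filter_upwards [hopen.mem_nhds hxO] with y hy
      rw [← hadd]
      exact hle y ⟨hy.1.le, hy.2.le⟩)
    (by rw [hxm, hadd])
  refine hB ?_
  -- Because `α ≥ 0`, the first summand is in `F`; the multiple of `I` pushes the sum into the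
  -- interior, which the dual subequation forbids.
  have hBeq : -B = (α * (2 * (‖x‖ ^ 2) ^ (-p / 2))) • rieszMat p (‖x‖⁻¹ • x) +
      (2 * ε) • (1 : SymMat n) := by
    apply Subtype.ext
    have h1 := hessian_radialSolution hk hx0 (-α) (-c + ε * t₂ ^ 2 + m) ε
    rw [AddSubgroup.coe_neg, hBh, h1, AddSubgroup.coe_add, selfAdjoint.val_smul,
      selfAdjoint.val_smul, selfAdjoint.val_one, neg_add, ← neg_smul, ← neg_smul]
    congr 2 <;> ring
  rw [hBeq]
  refine hF.add_smul_one_mem_interior (hcone _ (by positivity) _ (hp _ ?_)) (by positivity)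
  rw [norm_smul, norm_inv, norm_norm, inv_mul_cancel₀ (norm_ne_zero_iff.2 hx0)]

/-- Spherical averages of subharmonic functions which lie below a radial solution on the boundary
of a shell lie below it inside. -/
theorem IsSubharmonic.sphericalAverage_le {v : Rn n → EReal} (hF : IsSubequation F)
    (hcone : IsCone F) (hconv : Convex ℝ F) (hne : F.Nonempty)
    (hp : ∀ e : Rn n, ‖e‖ = 1 → rieszMat p e ∉ interior F)
    {Γ : Subgroup (Matrix.orthogonalGroup (Fin n) ℝ)} (hΓ : ∀ g ∈ Γ, ∀ A ∈ F, conj g A ∈ F)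
    {ν : Measure (Matrix.orthogonalGroup (Fin n) ℝ)} [IsProbabilityMeasure ν]
    (hνΓ : ∀ᵐ g ∂ν, g ∈ Γ)
    (hν : ∀ D : Rn n → ENNReal, Measurable D → ∀ y,
      ∫⁻ g, D (act g y) ∂ν = ∫⁻ σ : unitSphere n, D (‖y‖ • (σ : Rn n)) ∂sphereMeasure n)
    (hv : IsSubharmonic F (annulus n a b) v) (hvm : Measurable v)
    (hb₁ : sphericalAverage v t₁ ≤ ((α * k (t₁ ^ 2) + c : ℝ) : EReal))
    (hb₂ : sphericalAverage v t₂ ≤ ((α * k (t₂ ^ 2) + c : ℝ) : EReal)) {t : ℝ}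
    (ht : t ∈ Set.Icc t₁ t₂) :
    sphericalAverage v t ≤ ((α * k (t ^ 2) + c : ℝ) : EReal) := by
  by_contra! hcon
  obtain ⟨σ₀⟩ := id ‹Nonempty (unitSphere n)›
  have hσ₀ := mem_sphere_zero_iff_norm.1 σ₀.2
  have ht₁0 : 0 < t₁ := ha.trans_lt ht₁
  have ht0 : 0 < t := ht₁0.trans_le ht.1
  have hnorm : ‖t • (σ₀ : Rn n)‖ = t := by
    rw [norm_smul, hσ₀, mul_one, Real.norm_of_nonneg ht0.le]
  obtain ⟨d, hd1, hd2⟩ := EReal.lt_iff_exists_real_btwn.1 hcon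
  have hd1' : α * k (t ^ 2) + c < d := by exact_mod_cast hd1
  obtain ⟨ε, hε, hεd⟩ : ∃ ε : ℝ, 0 < ε ∧ ε * t₂ ^ 2 ≤ d - (α * k (t ^ 2) + c) := by
    have h2 : 0 < t₂ ^ 2 := pow_pos (ht0.trans_le ht.2) 2
    exact ⟨(d - (α * k (t ^ 2) + c)) / t₂ ^ 2, div_pos (by linarith) h2,
      by rw [div_mul_cancel₀ _ h2.ne']⟩
  have hne0 : ∀ y ∈ shell n t₁ t₂, y ≠ 0 := fun y hy h0 => by
    have := hy.1
    rw [h0, norm_zero] at this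
    linarith
  have hsub := shell_subset_annulus (n := n) ht₁ ht₂
  obtain ⟨M, hM0, hM⟩ := exists_bound (isCompact_shell n t₁ t₂) (hv.usc.mono hsub)
    fun y hy => hv.lt_top y (hsub hy)
  have husc := upperSemicontinuousOn_sphericalAverage hv.usc hvm hM0 hsub hM
  have heq : ∀ x ∈ shell n t₁ t₂, sphericalAverage v ‖x‖ =
      (M : EReal) - (sphereDeficit M v ‖x‖ : ENNReal) := fun x hx =>
    sphericalAverage_eq hvm hM0 fun σ => hM _ (by
      have : ‖‖x‖ • (σ : Rn n)‖ = ‖x‖ := by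
        rw [norm_smul, norm_norm, mem_sphere_zero_iff_norm.1 σ.2, mul_one]
      simpa only [shell, Set.mem_ofPred_eq, this] using hx)
  have hlt : ∀ x ∈ shell n t₁ t₂, sphericalAverage v ‖x‖ < ⊤ := fun x hx => by
    rw [heq x hx]
    refine lt_of_le_of_lt (EReal.sub_le_sub le_rfl (EReal.coe_ennreal_nonneg _)) ?_
    rw [sub_zero]
    exact EReal.coe_lt_top M
  set φ : ℝ → Rn n → ℝ := fun e y => α * k (‖y‖ ^ 2) + (e + -ε * ‖y‖ ^ 2)
  obtain ⟨x, ⟨hxK, hxO⟩, m, -, hxm, hle⟩ := exists_touching (O := {y | t₁ < ‖y‖ ∧ ‖y‖ < t₂})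
    (isCompact_shell n t₁ t₂) husc hlt
    (φ := φ (c + ε * t₂ ^ 2))
    (fun y hy => (contDiffAt_radialSolution hk (hne0 y hy) _ _ _).continuousAt.continuousWithinAt)
    (by
      intro y hy
      rcases mem_shell_boundary hy with hy' | hy'
      · simp only [φ, hy']
        refine hb₁.trans (EReal.coe_le_coe_iff.2 ?_)
        have : ε * t₁ ^ 2 ≤ ε * t₂ ^ 2 := by
          have := ht.1.trans ht.2
          gcongr
        linarith
      · simp only [φ, hy']
        refine hb₂.trans (EReal.coe_le_coe_iff.2 ?_)
        linarith)
    (x₀ := t • (σ₀ : Rn n)) (by simpa only [shell, Set.mem_ofPred_eq, hnorm, Set.mem_Icc] using ht)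
    (by
      simp only [φ, hnorm]
      refine lt_of_le_of_lt (EReal.coe_le_coe_iff.2 ?_) hd2
      have : 0 ≤ ε * t ^ 2 := by positivity
      linarith)
  have hopen : IsOpen {y : Rn n | t₁ < ‖y‖ ∧ ‖y‖ < t₂} :=
    (isOpen_lt continuous_const continuous_norm).inter (isOpen_lt continuous_norm continuous_const)
  have hx0 := hne0 x hxK
  set ψ := φ (c + ε * t₂ ^ 2 + m)
  have hadd : ∀ y, φ (c + ε * t₂ ^ 2) y + m = ψ y := fun y => by
    simp only [ψ, φ]; ring
  simp only [hadd] at hxm hle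
  have hunit : ‖‖x‖⁻¹ • x‖ = 1 := by
    rw [norm_smul, norm_inv, norm_norm, inv_mul_cancel₀ (norm_ne_zero_iff.2 hx0)]
  -- The functional is adapted to the direction of the contact point: it is nonpositive on the
  -- radial Hessian there, so the `ε`-term makes `ψ` a strict supersolution. The mean value
  -- inequality for the average then contradicts contact from above.
  obtain ⟨ℓ, hP, hI, hℓF, hℓ0⟩ := exists_supporting hF hcone hconv hne (hp _ hunit)
  obtain ⟨μ, hμprob, hμ⟩ := exists_harmonicMeasure hI hP
  have hψC : ContDiffAt ℝ 2 ψ x := contDiffAt_radialSolution hk hx0 _ _ _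
  have hψneg : ℓ (hessian ψ x) < 0 := by
    rw [hessian_radialSolution hk hx0, map_add, map_smul, map_smul, smul_eq_mul, smul_eq_mul]
    have h1 : 0 ≤ α * (2 * (‖x‖ ^ 2) ^ (-p / 2)) := by positivity
    have h2 := mul_nonpos_of_nonneg_of_nonpos h1 hℓ0
    have h3 : 0 < ε * ℓ 1 := mul_pos hε hI
    linarith
  have hev1 := eventually_integral_lt hI hμ hP hψC hψneg
  have hev2 : ∀ᶠ r in 𝓝[>] (0 : ℝ), Metric.closedBall x r ⊆ {y : Rn n | t₁ < ‖y‖ ∧ ‖y‖ < t₂} := by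
    obtain ⟨r₀, hr₀, hball⟩ := Metric.nhds_basis_closedBall.mem_iff.1 (hopen.mem_nhds hxO)
    filter_upwards [Ioo_mem_nhdsGT hr₀] with r hr
    exact (Metric.closedBall_subset_closedBall hr.2.le).trans hball
  obtain ⟨r, ⟨hcont, hlt'⟩, hrO, hr⟩ := (hev1.and (hev2.and self_mem_nhdsWithin)).exists
  have hr0 : 0 < r := hr
  have hOK : ∀ y ∈ Metric.closedBall x r, y ∈ shell n t₁ t₂ := fun y hy =>
    ⟨(hrO hy).1.le, (hrO hy).2.le⟩
  have hmean := hv.lintegral_sphereDeficit_le hcone hΓ hνΓ hν hI hP hℓF hμ hvm hr0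
    (fun y hy => hsub (hOK y hy)) (M := M) (fun g y hy => hM _ (by
      simpa only [shell, Set.mem_ofPred_eq, norm_act] using hOK y hy))
  obtain ⟨hxD, hxM⟩ := eq_ofReal_of_coe_sub_eq ((heq x hxK).symm.trans hxm)
  have hσmem : ∀ σ : unitSphere n, x + r • (σ : Rn n) ∈ shell n t₁ t₂ := fun σ => hOK _ (by
    rw [Metric.mem_closedBall, dist_eq_norm, add_sub_cancel_left, norm_smul,
      mem_sphere_zero_iff_norm.1 σ.2, mul_one, Real.norm_of_nonneg hr0.le])
  have hσD : ∀ σ : unitSphere n, ENNReal.ofReal (M - ψ (x + r • (σ : Rn n))) ≤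
      sphereDeficit M v ‖x + r • (σ : Rn n)‖ := fun σ =>
    ofReal_le_of_coe_sub_le ((heq _ (hσmem σ)).symm.trans_le (hle _ (hσmem σ)))
  have hchain := (lintegral_mono hσD).trans hmean
  rw [hxD] at hchain
  have hintψ : Integrable (fun σ : unitSphere n => ψ (x + r • (σ : Rn n))) μ :=
    hcont.integrable_of_hasCompactSupport (HasCompactSupport.of_compactSpace _)
  have hfin : ∫ σ : unitSphere n, (M - ψ (x + r • (σ : Rn n))) ∂μ ≤ M - ψ x := by
    have hint : Integrable (fun σ : unitSphere n => M - ψ (x + r • (σ : Rn n))) μ :=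
      (integrable_const M).sub hintψ
    -- `M - ψ` may be negative on part of the sphere; its positive part is what `hchain` controls,
    -- and dropping the negative part only increases the integral.
    rw [integral_eq_lintegral_pos_part_sub_lintegral_neg_part hint]
    refine (sub_le_self _ ENNReal.toReal_nonneg).trans ?_
    have := ENNReal.toReal_mono ENNReal.ofReal_ne_top hchain
    rwa [ENNReal.toReal_ofReal hxM] at this
  rw [integral_sub (integrable_const M) hintψ] at hfin
  simp only [integral_const, probReal_univ, smul_eq_mul, one_mul] at hfin
  linarith

end Comparison

/-! ### Null sets in polar coordinates. -/

theorem volume_eq_zero_iff_polar {n : ℕ} [Nonempty (unitSphere n)] {N : Set (Rn n)}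
    (hN : MeasurableSet N) :
    volume N = 0 ↔ ∀ᵐ r ∂(Measure.volumeIoiPow (Module.finrank ℝ (Rn n) - 1)),
      ∀ᵐ σ : unitSphere n ∂(volume : Measure (Rn n)).toSphere, r.1 • (σ : Rn n) ∉ N := by
  obtain ⟨σ₀⟩ := id ‹Nonempty (unitSphere n)›
  have hnt : Nontrivial (Rn n) := ⟨σ₀, 0, fun h => by
    have := mem_sphere_zero_iff_norm.1 σ₀.2
    rw [h] at this; simp at this⟩
  set V := Measure.volumeIoiPow (Module.finrank ℝ (Rn n) - 1)
  set S := (volume : Measure (Rn n)).toSphere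
  set s : Set (unitSphere n × Set.Ioi (0 : ℝ)) := {q | q.2.1 • (q.1 : Rn n) ∈ N}
  have hs : MeasurableSet s := by
    have hc : Continuous fun q : unitSphere n × Set.Ioi (0 : ℝ) => q.2.1 • (q.1 : Rn n) := by
      fun_prop
    exact hc.measurable hN
  have h := Measure.measurePreserving_homeomorphUnitSphereProd (volume : Measure (Rn n))
  have hpre : homeomorphUnitSphereProd (Rn n) ⁻¹' s = Subtype.val ⁻¹' N := by
    ext x
    have hx : ‖(x : Rn n)‖ ≠ 0 := norm_ne_zero_iff.2 x.2
    simp [s, homeomorphUnitSphereProd, smul_smul, hx]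
  have h1 : volume N = (S.prod V) s := by
    rw [← h.measure_preimage hs.nullMeasurableSet, hpre,
      comap_subtype_coe_apply (measurableSet_singleton _).compl, Subtype.image_preimage_coe,
      Set.inter_comm, ← Set.sdiff_eq, measure_sdiff_null (measure_singleton _)]
  have h2 : (S.prod V) s = (V.prod S) (Prod.swap ⁻¹' s) := by
    rw [← Measure.prod_swap, Measure.map_apply measurable_swap hs]
  rw [h1, h2, Measure.measure_prod_null (measurable_swap hs)]
  refine Filter.eventually_congr (Filter.Eventually.of_forall fun r => ?_)
  rw [ae_iff]
  simp only [not_not]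
  rfl

theorem exists_small_radius {n : ℕ} {P : Set.Ioi (0 : ℝ) → Prop}
    (hP : ∀ᵐ r ∂(Measure.volumeIoiPow n), P r) {δ : ℝ} (hδ : 0 < δ) :
    ∃ r : Set.Ioi (0 : ℝ), r.1 < δ ∧ P r := by
  by_contra! hcon
  have h1 : Measure.volumeIoiPow n (Set.Iio (⟨δ, Set.mem_Ioi.2 hδ⟩ : Set.Ioi (0 : ℝ))) = 0 := by
    refine measure_mono_null (fun r hr => ?_) hP
    exact hcon r hr
  rw [Measure.volumeIoiPow_apply_Iio, ENNReal.ofReal_eq_zero] at h1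
  have : 0 < δ ^ (n + 1) / (n + 1) := by positivity
  linarith

/-! ### Assembling the maximality criterion. -/

theorem IsSubharmonic.congr {n : ℕ} {F : Set (SymMat n)} {X : Set (Rn n)} (hX : IsOpen X)
    {u u' : Rn n → EReal} (hu : IsSubharmonic F X u) (h : ∀ x ∈ X, u' x = u x) :
    IsSubharmonic F X u' := by
  refine ⟨fun x hx c hc => ?_, fun x hx => by rw [h x hx]; exact hu.lt_top x hx,
    fun x hx φ hφ hle heq => hu.viscosity x hx φ hφ ?_ (by rw [← h x hx, heq])⟩
  · have hc' : u x < c := by rwa [← h x hx]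
    filter_upwards [hu.usc x hx c hc', self_mem_nhdsWithin] with y hy hyX
    rw [h y hyX]
    exact hy
  · filter_upwards [hle, hX.mem_nhds hx] with y hy hyX
    rwa [← h y hyX]

theorem IsSubharmonic.max {n : ℕ} {F : Set (SymMat n)} {X : Set (Rn n)}
    {u v : Rn n → EReal} (hu : IsSubharmonic F X u) (hv : IsSubharmonic F X v) :
    IsSubharmonic F X fun x => Max.max (u x) (v x) := by
  refine ⟨fun x hx c hc => ?_, fun x hx => max_lt (hu.lt_top x hx) (hv.lt_top x hx),
    fun x hx φ hφ hle heq => ?_⟩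
  · have hc' := max_lt_iff.1 hc
    filter_upwards [hu.usc x hx c hc'.1, hv.usc x hx c hc'.2] with y h1 h2
    exact max_lt h1 h2
  · rcases max_choice (u x) (v x) with h | h
    · exact hu.viscosity x hx φ hφ (hle.mono fun y hy => (le_max_left _ _).trans hy)
        (h.symm.trans heq)
    · exact hv.viscosity x hx φ hφ (hle.mono fun y hy => (le_max_right _ _).trans hy)
        (h.symm.trans heq)

theorem sphericalAverage_congr {n : ℕ} {u u' : Rn n → EReal} {t : ℝ}
    (h : ∀ σ : unitSphere n, u (t • (σ : Rn n)) = u' (t • (σ : Rn n))) :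
    sphericalAverage u t = sphericalAverage u' t := by
  unfold sphericalAverage
  rw [lintegral_congr fun σ => congrArg EReal.toENNReal (h σ),
    lintegral_congr fun σ => congrArg (fun e : EReal => (-e).toENNReal) (h σ)]

theorem le_of_deficit_le {e f : EReal} {M : ℝ} (he : e ≤ M)
    (h : ((M : EReal) - f).toENNReal ≤ ((M : EReal) - e).toENNReal) : e ≤ f := by
  induction e using EReal.rec with
  | bot => exact bot_le
  | top => simp at he
  | coe x =>
    have hx : x ≤ M := by exact_mod_cast he
    induction f using EReal.rec with
    | bot =>
      rw [← EReal.coe_sub, EReal.toENNReal_of_ne_top (EReal.coe_ne_top _)] at h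
      simp at h
    | top => exact le_top
    | coe y =>
      simp only [← EReal.coe_sub, EReal.toENNReal_of_ne_top (EReal.coe_ne_top _),
        EReal.toReal_coe] at h
      rw [ENNReal.ofReal_le_ofReal_iff (by linarith)] at h
      exact_mod_cast (by linarith : x ≤ y)

theorem deficit_le_of_sub_le {M : ℝ} {D E : ENNReal}
    (h : (M : EReal) - (D : EReal) ≤ (M : EReal) - (E : EReal)) : E ≤ D := by
  by_cases hD : D = ⊤
  · simp [hD]
  lift D to NNReal using hD
  by_cases hE : E = ⊤
  · subst hE
    have h' : (M : EReal) - ((D : ℝ) : EReal) ≤ ⊥ := h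
    rw [← EReal.coe_sub, le_bot_iff] at h'
    exact absurd h' (EReal.coe_ne_bot _)
  lift E to NNReal using hE
  change (M : EReal) - ((D : ℝ) : EReal) ≤ (M : EReal) - ((E : ℝ) : EReal) at h
  rw [← EReal.coe_sub, ← EReal.coe_sub, EReal.coe_le_coe_iff] at h
  have : (E : ℝ) ≤ D := by linarith
  exact_mod_cast this

theorem exists_shell {n : ℕ} {a : ℝ} {b : EReal} {K : Set (Rn n)} (hK : IsCompact K)
    (hKX : K ⊆ annulus n a b) {x₀ : Rn n} (hx₀ : x₀ ∈ annulus n a b) :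
    ∃ t₁ t₂ : ℝ, a < t₁ ∧ t₁ < ‖x₀‖ ∧ ‖x₀‖ < t₂ ∧ (t₂ : EReal) < b ∧
      ∀ y ∈ K, t₁ < ‖y‖ ∧ ‖y‖ < t₂ := by
  have hK' := hK.insert x₀
  obtain ⟨y₁, hy₁, hmin⟩ := hK'.exists_isMinOn ⟨x₀, Set.mem_insert _ _⟩ continuous_norm.continuousOn
  obtain ⟨y₂, hy₂, hmax⟩ := hK'.exists_isMaxOn ⟨x₀, Set.mem_insert _ _⟩ continuous_norm.continuousOn
  have hsub : insert x₀ K ⊆ annulus n a b := Set.insert_subset hx₀ hKX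
  obtain ⟨t₁, ht₁, ht₁'⟩ := exists_between (hsub hy₁).1
  obtain ⟨t₂, ht₂, ht₂'⟩ := EReal.lt_iff_exists_real_btwn.1 (hsub hy₂).2
  have ht₂r : ‖y₂‖ < t₂ := by exact_mod_cast ht₂
  have hall : ∀ y ∈ insert x₀ K, t₁ < ‖y‖ ∧ ‖y‖ < t₂ := fun y hy =>
    ⟨ht₁'.trans_le (hmin hy), lt_of_le_of_lt (hmax hy) ht₂r⟩
  exact ⟨t₁, t₂, ht₁, (hall x₀ (Set.mem_insert _ _)).1, (hall x₀ (Set.mem_insert _ _)).2, ht₂',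
    fun y hy => hall y (Set.mem_insert_of_mem _ hy)⟩

theorem lt_of_radialSolution {p : ℝ} {k : ℝ → ℝ}
    (hk : ∀ q, 0 < q → ContDiffAt ℝ 2 k q ∧ HasDerivAt k (q ^ (-p / 2)) q) {q₁ q₂ : ℝ}
    (h₁ : 0 < q₁) (h₂ : q₁ < q₂) : k q₁ < k q₂ := by
  refine strictMonoOn_of_deriv_pos (convex_Icc q₁ q₂) (fun q hq => ?_) (fun q hq => ?_)
    (Set.left_mem_Icc.2 h₂.le) (Set.right_mem_Icc.2 h₂.le) h₂
  · exact (hk q (h₁.trans_le hq.1)).2.continuousAt.continuousWithinAt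
  · rw [interior_Icc] at hq
    have hq0 := h₁.trans hq.1
    rw [(hk q hq0).2.deriv]
    positivity

/-- If `v` satisfies the sub-mean value property, `u` is upper semicontinuous, and the two agree
almost everywhere on the spheres about the origin, then `v ≤ u` everywhere. -/
theorem le_of_ae_eq_sphere {n : ℕ} [Nonempty (unitSphere n)] {X : Set (Rn n)}
    {u v : Rn n → EReal} (hu : UpperSemicontinuousOn u X)
    (hum : Measurable u) (hvm : Measurable v) {M t₁ t₂ : ℝ}
    {x₀ : Rn n} (hx₀ : t₁ < ‖x₀‖ ∧ ‖x₀‖ < t₂) (hsX : shell n t₁ t₂ ⊆ X)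
    (hvM : ∀ y ∈ shell n t₁ t₂, v y ≤ M)
    (hmean : ∀ r, 0 < r → Metric.closedBall x₀ r ⊆ shell n t₁ t₂ →
      ∫⁻ σ : unitSphere n, ((M : EReal) - v (x₀ + r • (σ : Rn n))).toENNReal ∂sphereMeasure n ≤
        ((M : EReal) - v x₀).toENNReal)
    (hae : ∀ t ∈ Set.Icc t₁ t₂, ∀ᵐ σ : unitSphere n ∂sphereMeasure n,
      ((M : EReal) - v (t • (σ : Rn n))).toENNReal =
        ((M : EReal) - u (t • (σ : Rn n))).toENNReal) :
    v x₀ ≤ u x₀ := by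
  have hprob := isProbabilityMeasure_sphereMeasure (n := n)
  have hac : ∀ Q : unitSphere n → Prop, (∀ᵐ σ ∂sphereMeasure n, Q σ) ↔
      ∀ᵐ σ ∂(volume : Measure (Rn n)).toSphere, Q σ := fun Q => by
    unfold sphereMeasure
    rw [Measure.ae_ennreal_smul_measure_iff (ENNReal.inv_ne_zero.2 (measure_ne_top _ _))]
  set O : Set (Rn n) := {y | t₁ < ‖y‖ ∧ ‖y‖ < t₂}
  have hO : IsOpen O :=
    (isOpen_lt continuous_const continuous_norm).inter (isOpen_lt continuous_norm continuous_const)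
  have hOs : O ⊆ shell n t₁ t₂ := fun y hy => ⟨hy.1.le, hy.2.le⟩
  have hDv := measurable_deficit hvm M
  have hDu := measurable_deficit hum M
  set N : Set (Rn n) := O ∩ {y | ((M : EReal) - v y).toENNReal ≠ ((M : EReal) - u y).toENNReal}
  have hN : MeasurableSet N := hO.measurableSet.inter (measurableSet_eq_fun hDv hDu).compl
  have hN0 : volume N = 0 := by
    refine (volume_eq_zero_iff_polar hN).2 (Filter.Eventually.of_forall fun r => ?_)
    by_cases hr : r.1 ∈ Set.Icc t₁ t₂
    · filter_upwards [(hac _).1 (hae r.1 hr)] with σ hσ hmem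
      exact hmem.2 hσ
    · refine Filter.Eventually.of_forall fun σ hmem => hr ?_
      have h1 : ‖r.1 • (σ : Rn n)‖ = r.1 := by
        rw [norm_smul, mem_sphere_zero_iff_norm.1 σ.2, mul_one, Real.norm_of_nonneg (le_of_lt r.2)]
      have h2 := hmem.1
      simp only [O, Set.mem_ofPred_eq, h1] at h2
      exact ⟨h2.1.le, h2.2.le⟩
  -- Polar coordinates about the origin showed that `N` is null. After translation, polar
  -- coordinates about `x₀` show that almost every sphere about `x₀` meets it in a null set, so
  -- arbitrarily small good radii exist.
  have hN1 : volume ((fun y => x₀ + y) ⁻¹' N) = 0 := by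
    rw [measure_preimage_add, hN0]
  have hpol := (volume_eq_zero_iff_polar ((measurable_const_add x₀) hN)).1 hN1
  refine le_of_deficit_le (hvM x₀ (hOs hx₀)) (le_of_forall_lt_imp_le_of_dense fun c hc => ?_)
  have hlsc := lowerSemicontinuousOn_sub_toENNReal (hu.mono (hOs.trans hsX)) M x₀ hx₀ c hc
  rw [hO.nhdsWithin_eq hx₀] at hlsc
  obtain ⟨δ, hδ, hball⟩ := Metric.eventually_nhds_iff.1 (hlsc.and (hO.mem_nhds hx₀))
  obtain ⟨r, hrδ, hr⟩ := exists_small_radius hpol hδ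
  have hr0 : 0 < r.1 := r.2
  have hσ : ∀ σ : unitSphere n, dist (x₀ + r.1 • (σ : Rn n)) x₀ < δ := fun σ => by
    rwa [dist_eq_norm, add_sub_cancel_left, norm_smul, mem_sphere_zero_iff_norm.1 σ.2, mul_one,
      Real.norm_of_nonneg hr0.le]
  refine le_trans ?_ (hmean r.1 hr0 fun y hy => hOs (hball (lt_of_le_of_lt hy hrδ)).2)
  calc c = ∫⁻ _ : unitSphere n, c ∂sphereMeasure n := by
        rw [lintegral_const, measure_univ, mul_one]
    _ ≤ _ := by
        refine lintegral_mono_ae ?_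
        filter_upwards [(hac _).2 hr] with σ hσN
        have h1 := hball (hσ σ)
        have h2 : ((M : EReal) - v (x₀ + r.1 • (σ : Rn n))).toENNReal =
            ((M : EReal) - u (x₀ + r.1 • (σ : Rn n))).toENNReal := by
          by_contra hne
          exact hσN ⟨h1.2, hne⟩
        rw [h2]
        exact le_of_lt h1.1

/-- If the spherical averages of an `F`-subharmonic function `U` on an annulus are increasing and
`F`-harmonic, then `U` is `F`-maximal. -/
theorem isMaximal_of_isHarmonic_sphericalAverage (n : ℕ) (F : Set (SymMat n))
    (hF : IsSubequation F) (hcone : IsCone F) (hconv : Convex ℝ F)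
    (hST : IsSTInvariant F)
    (a : ℝ) (b : EReal) (ha : 0 ≤ a)
    (U : Rn n → EReal)
    (hU : IsSubharmonic F (annulus n a b) U)
    (hmono : MonotoneOn (sphericalAverage U) {t : ℝ | a < t ∧ (t : EReal) < b})
    (hharm : IsHarmonic F (annulus n a b)
      (fun x => sphericalAverage U ‖x‖)) :
    IsMaximal F (annulus n a b) U := by
  classical
  refine ⟨hU, fun v hv K hKX hK hvU x₀ hx₀ => ?_⟩
  have hx₀0 : x₀ ≠ 0 := fun h => by
    have := hx₀.1
    rw [h, norm_zero] at this
    linarith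
  have hunit : ‖‖x₀‖⁻¹ • x₀‖ = 1 := by
    rw [norm_smul, norm_inv, norm_norm, inv_mul_cancel₀ (norm_ne_zero_iff.2 hx₀0)]
  have hnon : Nonempty (unitSphere n) := ⟨⟨‖x₀‖⁻¹ • x₀, mem_sphere_zero_iff_norm.2 hunit⟩⟩
  obtain ⟨σ₀⟩ := id hnon
  have hprob := isProbabilityMeasure_sphereMeasure (n := n)
  have hX := isOpen_annulus n a b
  set X := annulus n a b
  have hSbot : ∀ x ∈ X, sphericalAverage U ‖x‖ ≠ ⊥ := fun x hx h => by
    have := hharm.2.lt_top x hx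
    simp only [h, EReal.neg_bot, lt_self_iff_false] at this
  have hStop : ∀ x ∈ X, sphericalAverage U ‖x‖ ≠ ⊤ := fun x hx => (hharm.1.lt_top x hx).ne
  have hne : F.Nonempty := hharm.1.nonempty_of_ne_bot hX hx₀ (hSbot x₀ hx₀)
  -- The dual of the full space is empty, whereas minus the average is finite and subharmonic for
  -- the dual.
  have huniv : F ≠ Set.univ := fun h => by
    obtain ⟨A, hA⟩ := hharm.2.nonempty_of_ne_bot hX hx₀ (by
      simpa [EReal.neg_eq_bot_iff] using hStop x₀ hx₀)
    simp [dual, h] at hA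
  obtain ⟨G, htrans, hG⟩ := hST
  obtain ⟨p, hp⟩ := exists_rieszCharacteristic hF hcone hconv hne huniv hG htrans
  obtain ⟨k, hk⟩ := exists_radialSolution p
  obtain ⟨ν, hνprob, hνΓ, hν⟩ := exists_averaging_measure G htrans
  have hΓ := conj_mem_of_mem_closure hF.isClosed hG
  obtain ⟨t₁, t₂, ht₁, hx₁, hx₂, ht₂, hKt⟩ := exists_shell hK hKX hx₀
  have ht₁0 : 0 < t₁ := ha.trans_lt ht₁
  have ht₁₂ : t₁ < t₂ := hx₁.trans hx₂
  have hsX : shell n t₁ t₂ ⊆ X := shell_subset_annulus ht₁ ht₂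
  have hnorm : ∀ t, 0 < t → ∀ σ : unitSphere n, ‖t • (σ : Rn n)‖ = t := fun t ht σ => by
    rw [norm_smul, mem_sphere_zero_iff_norm.1 σ.2, mul_one, Real.norm_of_nonneg ht.le]
  have hsh : ∀ t ∈ Set.Icc t₁ t₂, ∀ σ : unitSphere n, t • (σ : Rn n) ∈ shell n t₁ t₂ :=
    fun t ht σ => by
      simpa only [shell, Set.mem_ofPred_eq, hnorm t (ht₁0.trans_le ht.1) σ, Set.mem_Icc] using ht
  have hS : ∀ t ∈ Set.Icc t₁ t₂, ∃ s : ℝ, sphericalAverage U t = s := fun t ht => by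
    have h1 := hSbot _ (hsX (hsh t ht σ₀))
    have h2 := hStop _ (hsX (hsh t ht σ₀))
    rw [hnorm t (ht₁0.trans_le ht.1) σ₀] at h1 h2
    exact ⟨_, (EReal.coe_toReal h2 h1).symm⟩
  set U' : Rn n → EReal := fun x => if x ∈ X then U x else ⊥
  -- Taking the maximum with `U` keeps subharmonicity and the values off `K`, and gives `U ≤ v'`, so
  -- that an inequality of averages can force equality.
  set v' : Rn n → EReal := fun x => if x ∈ X then max (v x) (U x) else ⊥
  have hU'X : ∀ x ∈ X, U' x = U x := fun x hx => if_pos hx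
  have hv'X : ∀ x ∈ X, v' x = max (v x) (U x) := fun x hx => if_pos hx
  have hU' : IsSubharmonic F X U' := hU.congr hX hU'X
  have hv' : IsSubharmonic F X v' := (hv.max hU).congr hX hv'X
  have hU'm : Measurable U' := measurable_ite_of_upperSemicontinuousOn hX hU.usc
  have hv'm : Measurable v' := measurable_ite_of_upperSemicontinuousOn hX (hv.max hU).usc
  have hUv : ∀ x, U' x ≤ v' x := fun x => by
    by_cases hx : x ∈ X
    · rw [hU'X x hx, hv'X x hx]; exact le_max_right _ _
    · simp [U', hx]
  obtain ⟨M, hM0, hM⟩ := exists_bound (isCompact_shell n t₁ t₂) (hv'.usc.mono hsX)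
    fun y hy => hv'.lt_top y (hsX hy)
  have hSU' : ∀ t ∈ Set.Icc t₁ t₂, sphericalAverage U t = sphericalAverage U' t := fun t ht =>
    sphericalAverage_congr fun σ => (hU'X _ (hsX (hsh t ht σ))).symm
  have hbd : ∀ t ∈ Set.Icc t₁ t₂, (∀ y ∈ K, ‖y‖ ≠ t) →
      sphericalAverage v' t = sphericalAverage U t := fun t ht hKt' =>
    sphericalAverage_congr fun σ => by
      have hmem := hsX (hsh t ht σ)
      rw [hv'X _ hmem]
      refine max_eq_right (hvU _ ⟨hmem, fun hK' => hKt' _ hK' (hnorm t (ht₁0.trans_le ht.1) σ)⟩)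
  have hbd₁ := hbd t₁ (Set.left_mem_Icc.2 ht₁₂.le) fun y hy => (hKt y hy).1.ne'
  have hbd₂ := hbd t₂ (Set.right_mem_Icc.2 ht₁₂.le) fun y hy => (hKt y hy).2.ne
  obtain ⟨s₁, hs₁⟩ := hS t₁ (Set.left_mem_Icc.2 ht₁₂.le)
  obtain ⟨s₂, hs₂⟩ := hS t₂ (Set.right_mem_Icc.2 ht₁₂.le)
  -- The monotonicity of the averages enters here, through the endpoints of the shell, and makes the
  -- coefficient `α` nonnegative.
  have hs₁₂ : s₁ ≤ s₂ := by
    have h := hmono (a := t₁) (b := t₂)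
      ⟨ht₁, (EReal.coe_lt_coe_iff.2 ht₁₂).trans ht₂⟩ ⟨ht₁.trans ht₁₂, ht₂⟩ ht₁₂.le
    rw [hs₁, hs₂] at h
    exact_mod_cast h
  have hk₁₂ : k (t₁ ^ 2) < k (t₂ ^ 2) :=
    lt_of_radialSolution hk (by positivity) (by gcongr)
  obtain ⟨α, c, hα, hc₁, hc₂⟩ : ∃ α c : ℝ, 0 ≤ α ∧ α * k (t₁ ^ 2) + c = s₁ ∧
      α * k (t₂ ^ 2) + c = s₂ := by
    have hd : k (t₂ ^ 2) - k (t₁ ^ 2) ≠ 0 := by linarith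
    refine ⟨(s₂ - s₁) / (k (t₂ ^ 2) - k (t₁ ^ 2)),
      s₁ - (s₂ - s₁) / (k (t₂ ^ 2) - k (t₁ ^ 2)) * k (t₁ ^ 2),
      div_nonneg (by linarith) (by linarith), by ring, ?_⟩
    field_simp
    ring
  have hle : ∀ t ∈ Set.Icc t₁ t₂, sphericalAverage v' t ≤ sphericalAverage U' t := fun t ht => by
    rw [← hSU' t ht]
    refine le_trans (IsSubharmonic.sphericalAverage_le hk ha ht₁ ht₂ hα (c := c) hF hcone hconv hne
      (fun e he => (hp e he).2) hΓ hνΓ hν hv' hv'm ?_ ?_ ht)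
      (IsSubharmonic.radial_le hk ha ht₁ ht₂ hα hF hcone (fun e he => (hp e he).1) hharm.2 ?_ ?_ ht)
    · rw [hbd₁, hs₁, hc₁]
    · rw [hbd₂, hs₂, hc₂]
    · rw [hs₁, hc₁]
    · rw [hs₂, hc₂]
  have hMv : ∀ t ∈ Set.Icc t₁ t₂, ∀ σ : unitSphere n, v' (t • (σ : Rn n)) ≤ M := fun t ht σ =>
    hM _ (hsh t ht σ)
  have hae : ∀ t ∈ Set.Icc t₁ t₂, ∀ᵐ σ : unitSphere n ∂sphereMeasure n,
      ((M : EReal) - v' (t • (σ : Rn n))).toENNReal =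
        ((M : EReal) - U' (t • (σ : Rn n))).toENNReal := fun t ht => by
    have hEv := sphericalAverage_eq hv'm hM0 (hMv t ht)
    have hEU := sphericalAverage_eq hU'm hM0 fun σ => (hUv _).trans (hMv t ht σ)
    have hDle : sphereDeficit M U' t ≤ sphereDeficit M v' t :=
      deficit_le_of_sub_le (by rw [← hEv, ← hEU]; exact hle t ht)
    have hpt : ∀ σ : unitSphere n, ((M : EReal) - v' (t • (σ : Rn n))).toENNReal ≤
        ((M : EReal) - U' (t • (σ : Rn n))).toENNReal := fun σ => antitone_sub_toENNReal M (hUv _)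
    have hUfin : sphereDeficit M U' t ≠ ⊤ := fun htop => by
      obtain ⟨s, hs⟩ := hS t ht
      rw [hSU' t ht, hEU, htop] at hs
      have hs' : (⊥ : EReal) = s := hs
      exact EReal.coe_ne_bot _ hs'.symm
    -- The deficits are ordered pointwise one way and their integrals the other way. The integrals
    -- are finite because the harmonic average of `U` is finite, so equality holds almost
    -- everywhere.
    refine ae_eq_of_ae_le_of_lintegral_le (Filter.Eventually.of_forall hpt)
      ((lintegral_mono hpt).trans_lt (lt_top_iff_ne_top.2 hUfin)).ne ?_ hDle
    exact ((measurable_deficit hU'm M).comp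
      ((continuous_const_smul t).comp continuous_subtype_val).measurable).aemeasurable
  -- Here `ℓ` only serves to obtain the mean value inequality on spheres about `x₀`; the boundary
  -- point at which it supports `F` is immaterial.
  obtain ⟨ℓ, hP, hI, hℓF, -⟩ := exists_supporting hF hcone hconv hne (hp _ hunit).2
  obtain ⟨μ, hμprob, hμ⟩ := exists_harmonicMeasure hI hP
  have hfinal : v' x₀ ≤ U' x₀ :=
    le_of_ae_eq_sphere hU'.usc hU'm hv'm ⟨hx₁, hx₂⟩ hsX hM
      (fun r hr hball => hv'.lintegral_sphere_le hcone hΓ hνΓ hν hI hP hℓF hμ hv'm hr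
        (hball.trans hsX) fun y hy => hM y (hball hy)) hae
  rw [hU'X x₀ hx₀, hv'X x₀ hx₀] at hfinal
  exact (le_max_left _ _).trans hfinal

end STCone

end

theorem theorem8p2 (n : ℕ) (F : Set (STCone.SymMat n))
    (hF : STCone.IsSubequation F) (hcone : STCone.IsCone F) (hconv : Convex ℝ F)
    (hST : STCone.IsSTInvariant F)
    (a : ℝ) (b : EReal) (ha : 0 ≤ a)
    (U : STCone.Rn n → EReal)
    (hU : STCone.IsSubharmonic F (STCone.annulus n a b) U)
    (hmono : MonotoneOn (STCone.sphericalAverage U) {t : ℝ | a < t ∧ (t : EReal) < b})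
    (hharm : STCone.IsHarmonic F (STCone.annulus n a b)
      (fun x => STCone.sphericalAverage U ‖x‖)) :
    STCone.IsMaximal F (STCone.annulus n a b) U := by
  exact STCone.isMaximal_of_isHarmonic_sphericalAverage n F hF hcone hconv hST a b ha U hU hmono
    hharm
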